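/- Logarithms $\log$ are to base $2$. **Setting.** Let $\mathcal H=(V,H)$ be a $k$-uniform hypergraph with $|V|=n$. For $0\le\rho\le1$ and $z\in\{\pm1\}^V$, let $\mathsf{plant}^{\rho}_{\mathcal H,z}$ be the law of $b=(b_e)_{e\in H}\in\{\pm1\}^H$ with $b_e=\eta_e\prod_{v\in e}z_v$, where the $\eta_e\in\{\pm1\}$ are independent with $\mathbb E[\eta_e]=\rho$. The Null case is $b\sim\mathsf{plant}^{0}_{\mathcal H,z}$ and the Planted case is $b\sim\mathsf{plant}^{\rho}_{\mathcal H,z}$ with $0<\rho\le 1$. A set $F\subseteq H$ is an *even cover* if every vertex lies in an even number of members of $F$. A partition $\pi$ of $H$ *shatters* $F\subseteq H$ if every part of $\pi$ contains at most one element of $F$. An *equipartition* is a partition into parts whose sizes differ pairwise by at most one. **Algorithm.** Parameters: $N,T\in\mathbb N$ and $\varepsilon>0$. Input: a set $\mathcal C$ of even covers of $\mathcal H$ and signs $b\in\{\pm1\}^H$. 1. Repeat at most $S=\lceil 10e^{2T}\rceil$ times: sample (independently) a uniformly random equipartition $\pi$ of $H$ into $2T$ parts, and let $\mathcal C'\subseteq\mathcal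 C$ be the set of members of $\mathcal C$ shattered by $\pi$; leave the loop as soon as $|\mathcal C'|\ge N^{\varepsilon}\,0.1^{T}$. If this never happens, output Fail. 2. If $|\mathcal C'|>N^\varepsilon\, 0.1^T$, replace $\mathcal C'$ by $\lceil N^{\varepsilon}\,0.1^{T}\rceil$ arbitrary members of it, chosen by any rule that does not look at $b$ or at the $\xi_e$ below. 3. Sample independent $\xi_e\sim\mathsf{Unif}([0,1])$, $e\in H$, and put $x_e=\xi_e b_e$. Output Planted if $\bigl|\sum_{F\in\mathcal C'}\prod_{e\in F}x_e\bigr|\ge N^{0.6\varepsilon}$, and Null otherwise. **Statement.** There is a universal constant $C_{\mathrm{anti}}>1.2$ with the following two properties. (a) (Linear anticoncentration.) If $x_1,\dots,x_r$ are independent real random variables, each of mean zero, supported on $[-2,2]$ and with a probability density bounded by $1$, then for all $c_1,\dots,c_r\in\mathbb R$ and all $0<\eta<1/2$, $$\Pr\bigl[\,|c_1x_1+\dots+c_rx_r-1|\le\eta\,\bigr]\le C_{\mathrm{anti}}\,\eta\sqrt{\log(1/\eta)}.$$ (b) Let $\mathcal H$ be a $k$-uniform hypergraph on $n$ vertices,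 let $\ell,T\in\mathbb N$, $N=\binom n\ell$, $0<\rho\le1$, $\delta>0$, $\varepsilon>0$, and suppose $$4\log(1/\delta)<T<\frac{0.4\,\varepsilon\log N}{\log\bigl(10\,C_{\mathrm{anti}}^{40}\,\rho^{-4}\bigr)}.$$ Let $\mathcal C$ be a set of at least $10N^{\varepsilon}$ distinct nonempty even covers of $\mathcal H$, each of size at most $2T$. Then for every $z\in\{\pm1\}^V$ the algorithm outputs Null with probability at least $1-\delta$ if $b\sim\mathsf{plant}^{0}_{\mathcal H,z}$, and outputs Planted with probability at least $1-\delta$ if $b\sim\mathsf{plant}^{\rho}_{\mathcal H,z}$. (The probability is over $b$ and the independent coins of the algorithm; the output Fail counts as incorrect.) -/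

import Mathlib

open Finset MeasureTheory ProbabilityTheory

noncomputable section

/-- A `k`-uniform hypergraph on the vertex set `Fin n`. -/
structure UniformHypergraph (n k : ℕ) where
  edges : Finset (Finset (Fin n))
  uniform : ∀ e ∈ edges, e.card = k

namespace UniformHypergraph

variable {n k : ℕ}

/-- The type of hyperedges. -/
abbrev Edge (G : UniformHypergraph n k) : Type := {e : Finset (Fin n) // e ∈ G.edges}

/-- A set `F` of hyperedges is an even cover if every vertex lies in an even number of
members of `F`. -/
def IsEvenCover (G : UniformHypergraph n k) (F : Finset G.Edge) : Prop :=
  ∀ v : Fin n, Even (F.filter (fun e => v ∈ e.1)).card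

end UniformHypergraph

/-- The law of a random sign `η ∈ {1, -1}` with mean `ρ`. -/
def signLaw (ρ : ℝ) : Measure ℤˣ :=
  ENNReal.ofReal ((1 + ρ) / 2) • Measure.dirac 1 + ENNReal.ofReal ((1 - ρ) / 2) • Measure.dirac (-1)

/-- The `ρ`-planted `k`XOR distribution on right-hand sides `b : G.Edge → {1, -1}`:
`b e = η e * ∏ v ∈ e, z v` with independent signs `η e` of mean `ρ`.
The null distribution is the case `ρ = 0`. -/
def plantedLaw {n k : ℕ} (G : UniformHypergraph n k) (ρ : ℝ) (z : Fin n → ℤˣ) :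
    Measure (G.Edge → ℤˣ) :=
  (Measure.pi (fun _ : G.Edge => signLaw ρ)).map (fun η e => η e * ∏ v ∈ e.1, z v)

section Algorithm

variable {E : Type} [Fintype E] [DecidableEq E]

/-- A labelling of `E` by `t` labels is an equipartition (into `t` labelled parts) if the sizes of
any two parts differ by at most one. If `t` divides `|E|` all parts have the same size. -/
def IsEquipartition {t : ℕ} (π : E → Fin t) : Prop :=
  ∀ i j : Fin t, (univ.filter (fun e => π e = i)).card ≤ (univ.filter (fun e => π e = j)).card + 1

/-- `π` shatters `F` if every part contains at most one element of `F`. -/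
def Shatters {t : ℕ} (π : E → Fin t) (F : Finset E) : Prop :=
  ∀ j : Fin t, (F.filter (fun e => π e = j)).card ≤ 1

instance {t : ℕ} (π : E → Fin t) : DecidablePred (Shatters π) :=
  fun F => inferInstanceAs (Decidable (∀ j : Fin t, (F.filter (fun e => π e = j)).card ≤ 1))

/-- The members of `𝒞` that are shattered by `π`. -/
def shatteredPart {t : ℕ} (𝒞 : Finset (Finset E)) (π : E → Fin t) : Finset (Finset E) :=
  𝒞.filter (Shatters π)

/-- The polynomial `∑_{F ∈ 𝒞} ∏_{e ∈ F} x_e`, evaluated at `x`. -/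
def coverPoly (𝒞 : Finset (Finset E)) (x : E → ℝ) : ℝ := ∑ F ∈ 𝒞, ∏ e ∈ F, x e

/-- The possible outputs of the algorithm. -/
inductive Guess
  | fail
  | null
  | planted

/-- The target number `N ^ ε * 0.1 ^ T` of shattered covers. -/
def targetSize (N T : ℕ) (ε : ℝ) : ℝ := (N : ℝ) ^ ε * (0.1 : ℝ) ^ T

/-- The number `S = 10 * exp (2 T)` of iterations of the loop, rounded up. -/
def numIterations (T : ℕ) : ℕ := ⌈10 * Real.exp (2 * T)⌉₊

/-- `pick` is a rule that restricts every family with more than `s` members to `⌈s⌉` arbitrary ones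
of them. It may look at the partition, but neither at the signs nor at the multipliers. -/
def IsRestrictionRule {t : ℕ} (s : ℝ)
    (pick : (E → Fin t) → Finset (Finset E) → Finset (Finset E)) : Prop :=
  ∀ (π : E → Fin t) (A : Finset (Finset E)), s < (A.card : ℝ) →
    pick π A ⊆ A ∧ (pick π A).card = ⌈s⌉₊

/-- The algorithm, as a function of its input `𝒞`, `b` and of its random coins: the partitions
`πs 0, πs 1, …` sampled in the loop and the multipliers `ξ`. -/
def distinguish (N T : ℕ) (ε : ℝ)
    (pick : (E → Fin (2 * T)) → Finset (Finset E) → Finset (Finset E))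
    (𝒞 : Finset (Finset E)) (b : E → ℤˣ)
    (πs : Fin (numIterations T) → E → Fin (2 * T)) (ξ : E → ℝ) : Guess :=
  match (List.ofFn πs).find?
      (fun π => decide (targetSize N T ε ≤ ((shatteredPart 𝒞 π).card : ℝ))) with
  | none => Guess.fail
  | some π =>
    let 𝒞₁ := shatteredPart 𝒞 π
    let 𝒞₂ := if targetSize N T ε < (𝒞₁.card : ℝ) then pick π 𝒞₁ else 𝒞₁
    if (N : ℝ) ^ (0.6 * ε) ≤ |coverPoly 𝒞₂ (fun e => ξ e * ((b e : ℤ) : ℝ))| then Guess.planted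
    else Guess.null

variable (E) in
/-- The law of the coins: independent uniformly random equipartitions into `2 T` parts, and,
independently of them, i.i.d. multipliers that are uniform on `[0, 1]`. -/
def coinLaw (T : ℕ) : Measure ((Fin (numIterations T) → E → Fin (2 * T)) × (E → ℝ)) :=
  (Measure.pi (fun _ => uniformOn {π : E → Fin (2 * T) | IsEquipartition π})).prod
    (Measure.pi (fun _ => volume.restrict (Set.Icc (0 : ℝ) 1)))

/-- The probability that the algorithm, run on `𝒞` and on random signs `b` with law `μ`
that are independent of its coins, outputs `g`. -/
def outputProb (N T : ℕ) (ε : ℝ)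
    (pick : (E → Fin (2 * T)) → Finset (Finset E) → Finset (Finset E))
    (𝒞 : Finset (Finset E)) (μ : Measure (E → ℤˣ)) (g : Guess) : ℝ :=
  (μ.prod (coinLaw E T)).real {ω | distinguish N T ε pick 𝒞 ω.1 ω.2.1 ω.2.2 = g}

end Algorithm

/-- A law on `ℝ` is nice if it is a probability law with mean zero and support in `[-2, 2]`
that has a probability density function bounded by `1`. -/
def IsNiceLaw (ν : Measure ℝ) : Prop :=
  IsProbabilityMeasure ν ∧ ν (Set.Icc (-2) 2)ᶜ = 0 ∧ ∫ x, x ∂ν = 0 ∧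
    ∃ f : ℝ → ENNReal, Measurable f ∧ (∀ x, f x ≤ 1) ∧ ν = volume.withDensity f

/-- `C > 1.2` is an anticoncentration constant: for all independent `x 1, …, x r` with nice laws and
all real coefficients, `Pr[|∑ cᵢ xᵢ - 1| ≤ η] ≤ C η √(log₂ (1/η))` for all `0 < η < 1/2`. -/
def IsAnticoncentrationConstant (C : ℝ) : Prop :=
  1.2 < C ∧ ∀ (r : ℕ) (ν : Fin r → Measure ℝ), (∀ i, IsNiceLaw (ν i)) →
    ∀ (c : Fin r → ℝ) (η : ℝ), 0 < η → η < 1 / 2 →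
      (Measure.pi ν).real {x | |∑ i, c i * x i - 1| ≤ η} ≤ C * η * √(Real.logb 2 (1 / η))

end

/-!
The constant `C = 20000` works; each claim below has room to spare.

**Linear anticoncentration.** Let `S = ∑ c i * x i` and `σ ^ 2 = ∑ c i ^ 2`. If `σ ^ 2` is at most
`1 / (32 log (1 / η))`, then `S ≥ 1 / 2` already has probability at most `η` by Hoeffding's
inequality. Otherwise it suffices that `P(|S - a| ≤ r) = O(r / σ)`
(`measureReal_abs_linearForm_sub_le_div_sqrt`). For `r ≥ 5 max |c i|` this follows from Esseen's
inequality (`measureReal_Icc_le_integral_charFun`), because all characteristic functions involved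
are evaluated near `0`, where they have Gaussian decay (`IsNiceLaw.norm_charFun_le`). For smaller
`r`, resampling the variable with the largest coefficient `c j`, whose term has density at most
`1 / |c j|`, reduces the question to scale `|c j|`.

**The loop.** A set `F` of `2 T` elements is shattered with probability `p ≥ exp (-2 T)`. The
expected number of shattered covers only gives a failure probability `exp (-O(1))` after
`10 exp (2 T)` rounds, whereas `δ` may be as small as `2 ^ (-T / 4)`. The second moment supplies the
missing factor `T` in the exponent: for `F ≠ F'` of size `2 T` the conditional probability that `F'`
is shattered, given that `F` is, is `O(1 / T)` (`card_shattering_inter_mul_le`), so one round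
succeeds with probability of order `T exp (-2 T)` (`mul_exp_neg_mul_card_equipartitions_le`). Covers
with fewer than `2 T` elements are first extended to `2 T` elements; at most `4 ^ T` of them get the
same extension, which is negligible compared with the number of covers.

**The verdict.** On even covers the planted assignment cancels, so in both cases the polynomial is
evaluated at independent variables `ξ η`, with `η` a sign of mean `ρ`. In the null case distinct
monomials are uncorrelated and Chebyshev's inequality applies. In the planted case `ξ η - ρ / 2` has
a nice law, and given the variables of all other parts the polynomial is affine in the variables of
one part. Hence replacing the variables of one part by their means lowers `𝔼 |P| ^ (-1/4)` by at
most a constant factor, by linear anticoncentration. After all `2 T` parts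
this compares `|P|` with its mean (`lmarginal_invFourthRoot_coverPoly_le`,
`measure_abs_coverPoly_lt_le`), and Markov's inequality bounds the probability that `|P|` lies below
the threshold.
-/

/-! ### Anticoncentration of linear forms -/

namespace IsNiceLaw

variable {ν : Measure ℝ}

theorem isProbabilityMeasure (h : IsNiceLaw ν) : IsProbabilityMeasure ν := h.1

theorem le_volume (h : IsNiceLaw ν) : ν ≤ volume := by
  obtain ⟨f, -, hf, rfl⟩ := h.2.2.2
  calc volume.withDensity f ≤ volume.withDensity 1 := withDensity_mono (ae_of_all _ hf)
    _ = volume := withDensity_one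

theorem ae_mem_Icc (h : IsNiceLaw ν) : ∀ᵐ x ∂ν, x ∈ Set.Icc (-2 : ℝ) 2 := h.2.1

theorem integral_id (h : IsNiceLaw ν) : ∫ x, x ∂ν = 0 := h.2.2.1

theorem integrable_id (h : IsNiceLaw ν) : Integrable (fun x : ℝ => x) ν :=
  have := h.isProbabilityMeasure
  Integrable.of_mem_Icc (-2) 2 aemeasurable_id h.ae_mem_Icc

theorem integrable_sq (h : IsNiceLaw ν) : Integrable (fun x : ℝ => x ^ 2) ν := by
  have := h.isProbabilityMeasure
  refine Integrable.of_mem_Icc 0 4 (by fun_prop) ?_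
  filter_upwards [h.ae_mem_Icc] with x hx
  exact ⟨sq_nonneg x, by nlinarith [hx.1, hx.2]⟩

/-- A density bounded by `1` leaves mass at least `1 / 2` outside `[-1/4, 1/4]`. -/
theorem le_integral_sq (h : IsNiceLaw ν) : 1 / 32 ≤ ∫ x, x ^ 2 ∂ν := by
  have := h.isProbabilityMeasure
  set s : Set ℝ := Set.Icc (-(1 / 4)) (1 / 4)
  have hs : ν.real s ≤ 1 / 2 := by
    have : ν s ≤ ENNReal.ofReal (1 / 2) := by
      refine (h.le_volume s).trans ?_
      rw [Real.volume_Icc]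
      norm_num
    exact ENNReal.toReal_le_of_le_ofReal (by norm_num) this
  have hs' : 1 / 2 ≤ ν.real sᶜ := by
    rw [measureReal_compl measurableSet_Icc]
    simp only [probReal_univ]
    linarith
  calc (1 / 32 : ℝ) ≤ ∫ x, sᶜ.indicator (fun _ => (1 / 16 : ℝ)) x ∂ν := by
        rw [integral_indicator measurableSet_Icc.compl]
        simp only [integral_const, measureReal_restrict_apply_univ, smul_eq_mul]
        linarith
    _ ≤ ∫ x, x ^ 2 ∂ν := by
        refine integral_mono ((integrable_const _).indicator measurableSet_Icc.compl)
          h.integrable_sq fun x => ?_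
        by_cases hx : x ∈ s
        · simp only [Set.indicator, Set.mem_compl_iff, hx, not_true, if_false]
          positivity
        · simp only [Set.indicator, Set.mem_compl_iff, hx, not_false_iff, if_true]
          have hx' : ¬ |x| ≤ 1 / 4 := fun h' => hx (abs_le.1 h')
          rw [← sq_abs]
          nlinarith [abs_nonneg x]

end IsNiceLaw

theorem Real.cos_le_one_sub_sq_div_sixteen {w : ℝ} (hw : |w| ≤ 4) :
    Real.cos w ≤ 1 - w ^ 2 / 16 := by
  rcases le_total |w| Real.pi with h | h
  · refine (Real.cos_le_one_sub_mul_cos_sq h).trans ?_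
    have h1 : (1 : ℝ) / 16 ≤ 2 / Real.pi ^ 2 := by
      rw [div_le_div_iff₀ (by norm_num) (by positivity)]
      nlinarith [Real.pi_le_four, Real.pi_pos]
    nlinarith [sq_nonneg w]
  · have h1 : Real.cos w ≤ 0 := by
      rw [← Real.cos_abs]
      apply Real.cos_nonpos_of_pi_div_two_le_of_le <;> linarith [Real.pi_gt_three]
    have h2 : w ^ 2 ≤ 16 := by
      rw [← sq_abs]
      nlinarith [abs_nonneg w]
    linarith

/-- Near the origin the characteristic function of a nice law has Gaussian decay: rotating by its
argument `θ`, its modulus is the mean of `cos (u x - θ)`, and the quadratic bound for the cosine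
leaves the variance of `u x` because `x` has mean zero. -/
theorem IsNiceLaw.norm_charFun_le {ν : Measure ℝ} (h : IsNiceLaw ν) {u : ℝ} (hu : |u| ≤ 1 / 5) :
    ‖charFun ν u‖ ≤ Real.exp (-(u ^ 2 / 512)) := by
  have := h.isProbabilityMeasure
  set θ := Complex.arg (charFun ν u)
  have hθ : |θ| ≤ Real.pi := Complex.abs_arg_le_pi _
  have hint : Integrable (fun x : ℝ => Complex.exp (u * x * Complex.I)) ν := by
    refine Integrable.of_bound (by fun_prop) 1 (ae_of_all _ fun x => ?_)
    have := Complex.norm_exp_ofReal_mul_I (u * x)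
    push_cast at this
    exact this.le
  have h1 : ‖charFun ν u‖ = ∫ x, Real.cos (u * x - θ) ∂ν := by
    have e1 : ((‖charFun ν u‖ : ℝ) : ℂ) = charFun ν u * Complex.exp (-(θ * Complex.I)) := by
      conv_rhs => rw [← Complex.norm_mul_exp_arg_mul_I (charFun ν u)]
      rw [mul_assoc, ← Complex.exp_add]
      simp [θ]
    have e2 := congrArg Complex.re e1
    rw [Complex.ofReal_re, charFun_apply_real, ← integral_mul_const] at e2
    rw [charFun_apply_real, e2]
    have := integral_re (hint.mul_const (Complex.exp (-(θ * Complex.I))))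
    simp only [RCLike.re_to_complex] at this
    rw [← this]
    congr 1 with x
    rw [← Complex.exp_add]
    have : ((u * x * Complex.I : ℂ) + -(θ * Complex.I)) = ((u * x - θ : ℝ) : ℂ) * Complex.I := by
      push_cast; ring
    rw [this, Complex.exp_ofReal_mul_I_re]
  have hi1 : Integrable (fun x : ℝ => 1 - (u * x - θ) ^ 2 / 16) ν := by
    have : (fun x : ℝ => 1 - (u * x - θ) ^ 2 / 16) =
        fun x => (1 - θ ^ 2 / 16) + (-(u ^ 2 / 16) * x ^ 2 + u * θ / 8 * x) := by
      ext x; ring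
    rw [this]
    exact (integrable_const _).add ((h.integrable_sq.const_mul _).add (h.integrable_id.const_mul _))
  have h2 : ‖charFun ν u‖ ≤ 1 - θ ^ 2 / 16 - u ^ 2 / 16 * ∫ x, x ^ 2 ∂ν := by
    rw [h1]
    calc ∫ x, Real.cos (u * x - θ) ∂ν ≤ ∫ x, (1 - (u * x - θ) ^ 2 / 16) ∂ν := by
          refine integral_mono_ae ?_ hi1 ?_
          · refine Integrable.of_bound (by fun_prop) 1 (ae_of_all _ fun x => ?_)
            exact Real.abs_cos_le_one _
          · filter_upwards [h.ae_mem_Icc] with x hx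
            refine Real.cos_le_one_sub_sq_div_sixteen ?_
            have hx' : |x| ≤ 2 := abs_le.2 hx
            have : |u * x| ≤ 1 / 5 * 2 := by
              rw [abs_mul]; gcongr
            calc |u * x - θ| ≤ |u * x| + |θ| := abs_sub _ _
              _ ≤ 4 := by linarith [Real.pi_lt_d2]
      _ = ∫ x, ((1 - θ ^ 2 / 16) + (-(u ^ 2 / 16) * x ^ 2 + u * θ / 8 * x)) ∂ν := by
          congr 1 with x; ring
      _ = _ := by
          rw [integral_add (f := fun _ => 1 - θ ^ 2 / 16)
              (g := fun x => -(u ^ 2 / 16) * x ^ 2 + u * θ / 8 * x) (integrable_const _)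
              ((h.integrable_sq.const_mul _).add (h.integrable_id.const_mul _)),
            integral_add (h.integrable_sq.const_mul _) (h.integrable_id.const_mul _),
            integral_const_mul, integral_const_mul, h.integral_id]
          simp
          ring
  have h3 := h.le_integral_sq
  have h4 := Real.add_one_le_exp (-(u ^ 2 / 512))
  nlinarith [sq_nonneg u, sq_nonneg θ]

/-- **Esseen's inequality**, at unit scale: the function `x ↦ |∫₀¹ exp (i t x) dt| ^ 2` is
nonnegative, is at least `1 / 4` on `[-1, 1]`, and its mean is a mean of the characteristic
function. -/
theorem measureReal_Icc_le_integral_charFun (κ : Measure ℝ) [IsProbabilityMeasure κ] :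
    κ.real (Set.Icc (-1) 1) ≤ 4 * ∫ p : ℝ × ℝ, ‖charFun κ (p.1 - p.2)‖
      ∂((volume.restrict (Set.Icc (0 : ℝ) 1)).prod (volume.restrict (Set.Icc (0 : ℝ) 1))) := by
  set I := volume.restrict (Set.Icc (0 : ℝ) 1)
  have hI : IsProbabilityMeasure I := ⟨by simp [I]⟩
  set g : ℝ → ℂ := fun x => ∫ t, Complex.exp (t * x * Complex.I) ∂I
  have hexp : ∀ x t : ℝ, ‖Complex.exp (t * x * Complex.I)‖ = 1 := fun x t => by
    have := Complex.norm_exp_ofReal_mul_I (t * x)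
    push_cast at this
    exact this
  have hint : ∀ x : ℝ, Integrable (fun t : ℝ => Complex.exp (t * x * Complex.I)) I := fun x =>
    Integrable.of_bound (by fun_prop) 1 (ae_of_all _ fun t => (hexp x t).le)
  have hsq : ∀ x : ℝ, ((‖g x‖ ^ 2 : ℝ) : ℂ) =
      ∫ p : ℝ × ℝ, Complex.exp ((p.1 - p.2 : ℝ) * x * Complex.I) ∂(I.prod I) := fun x => by
    have e1 : (starRingEnd ℂ) (g x) = ∫ t : ℝ, Complex.exp (-(t * x * Complex.I)) ∂I := by
      rw [← integral_conj]
      congr 1 with t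
      rw [← Complex.exp_conj]
      simp
    have e2 : ((‖g x‖ ^ 2 : ℝ) : ℂ) = g x * (starRingEnd ℂ) (g x) := by
      rw [Complex.mul_conj, Complex.normSq_eq_norm_sq]
    rw [e2, e1, ← integral_prod_mul]
    congr 1 with p
    rw [← Complex.exp_add]
    congr 1
    push_cast; ring
  have hlow : ∀ x ∈ Set.Icc (-1 : ℝ) 1, 1 ≤ 4 * ‖g x‖ ^ 2 := fun x hx => by
    have h1 : (1 / 2 : ℝ) ≤ (g x).re := by
      have := integral_re (hint x)
      simp only [RCLike.re_to_complex] at this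
      rw [← this]
      calc (1 / 2 : ℝ) = ∫ t : ℝ, (1 / 2 : ℝ) ∂I := by simp
        _ ≤ _ := by
          refine integral_mono_ae (integrable_const _) (hint x).re ?_
          filter_upwards [ae_restrict_mem measurableSet_Icc] with t ht
          have e : (t * x * Complex.I : ℂ) = ((t * x : ℝ) : ℂ) * Complex.I := by push_cast; ring
          rw [e, Complex.exp_ofReal_mul_I_re]
          have htx : (t * x) ^ 2 ≤ 1 := by
            have : |t * x| ≤ 1 := by
              rw [abs_mul]
              exact mul_le_one₀ (abs_le.2 ⟨by linarith [ht.1], ht.2⟩) (abs_nonneg _) (abs_le.2 hx)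
            rw [← sq_abs]
            exact pow_le_one₀ (abs_nonneg _) this
          linarith [Real.one_sub_sq_div_two_le_cos (x := t * x)]
    have h2 := Complex.re_le_norm (g x)
    nlinarith
  have hjoint : Integrable (fun q : ℝ × (ℝ × ℝ) =>
      Complex.exp ((q.2.1 - q.2.2 : ℝ) * q.1 * Complex.I)) (κ.prod (I.prod I)) :=
    Integrable.of_bound (by fun_prop) 1 (ae_of_all _ fun q => (hexp _ _).le)
  have hint2 : Integrable (fun x => ‖g x‖ ^ 2) κ := by
    have h1 := hjoint.integral_prod_left
    simp only [← hsq] at h1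
    exact_mod_cast h1.re
  calc κ.real (Set.Icc (-1) 1) = ∫ x, (Set.Icc (-1 : ℝ) 1).indicator 1 x ∂κ := by
        rw [integral_indicator_one measurableSet_Icc]
    _ ≤ ∫ x, 4 * ‖g x‖ ^ 2 ∂κ := by
        refine integral_mono ((integrable_const (1 : ℝ)).indicator measurableSet_Icc)
          (hint2.const_mul _) fun x => ?_
        by_cases hx : x ∈ Set.Icc (-1 : ℝ) 1
        · simpa [Set.indicator_of_mem hx] using hlow x hx
        · simp only [Set.indicator_of_notMem hx]; positivity
    _ = 4 * ∫ x, ‖g x‖ ^ 2 ∂κ := integral_const_mul _ _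
    _ ≤ _ := by
        gcongr
        have e1 : ((∫ x, ‖g x‖ ^ 2 ∂κ : ℝ) : ℂ) =
            ∫ p : ℝ × ℝ, charFun κ (p.1 - p.2) ∂(I.prod I) := by
          rw [← integral_complex_ofReal]
          simp only [hsq]
          rw [integral_integral_swap hjoint]
          simp only [charFun_apply_real]
        calc ∫ x, ‖g x‖ ^ 2 ∂κ ≤ ‖((∫ x, ‖g x‖ ^ 2 ∂κ : ℝ) : ℂ)‖ := by
              rw [Complex.norm_real]; exact le_abs_self _
          _ ≤ _ := by rw [e1]; exact norm_integral_le_integral_norm _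

section LinearForm

variable {ι : Type*} [Fintype ι] {ν : ι → Measure ℝ}

theorem charFun_map_linearForm [∀ i, IsProbabilityMeasure (ν i)] (c : ι → ℝ) (u : ℝ) :
    charFun ((Measure.pi ν).map fun x => ∑ i, c i * x i) u = ∏ i, charFun (ν i) (c i * u) := by
  rw [charFun_apply_real, integral_map (by fun_prop : Measurable _).aemeasurable (by fun_prop)]
  simp only [charFun_apply_real]
  rw [← integral_fintype_prod_eq_prod (𝕜 := ℂ)
    (fun i (y : ℝ) => Complex.exp (((c i * u : ℝ) : ℂ) * y * Complex.I))]
  congr 1 with x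
  rw [← Complex.exp_sum]
  congr 1
  push_cast
  rw [Finset.mul_sum, Finset.sum_mul]
  refine Finset.sum_congr rfl fun i _ => ?_
  ring

/-- Small-ball estimate at scales at least `5 max |c i|`: there the characteristic function of the
linear form is only evaluated where all its factors have Gaussian decay. -/
theorem measureReal_abs_linearForm_sub_le (hν : ∀ i, IsNiceLaw (ν i)) (c : ι → ℝ) (a : ℝ) {r : ℝ}
    (hr : 0 < r) (hc : ∀ i, 5 * |c i| ≤ r) (hσ : 0 < ∑ i, c i ^ 2) :
    (Measure.pi ν).real {x | |∑ i, c i * x i - a| ≤ r} ≤ 161 * (r / √(∑ i, c i ^ 2)) := by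
  have := fun i => (hν i).isProbabilityMeasure
  set v := ∑ i, c i ^ 2
  set I := volume.restrict (Set.Icc (0 : ℝ) 1)
  have hI : IsProbabilityMeasure I := ⟨by simp [I]⟩
  set κ₀ := (Measure.pi ν).map fun x => ∑ i, c i / r * x i
  set κ := κ₀.map fun y => y + -(a / r)
  have hκ₀ : IsProbabilityMeasure κ₀ :=
    Measure.isProbabilityMeasure_map (by fun_prop : Measurable _).aemeasurable
  have hκ : IsProbabilityMeasure κ := Measure.isProbabilityMeasure_map (by fun_prop)
  set b := v / (512 * r ^ 2)
  have hb : 0 < b := by positivity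
  have hset : (Measure.pi ν).real {x | |∑ i, c i * x i - a| ≤ r} = κ.real (Set.Icc (-1) 1) := by
    simp only [κ, κ₀]
    rw [map_measureReal_apply (by fun_prop) measurableSet_Icc,
      map_measureReal_apply (by fun_prop) (measurableSet_Icc.preimage (by fun_prop))]
    congr 1
    ext x
    have : ∑ i, c i / r * x i + -(a / r) = (∑ i, c i * x i - a) / r := by
      rw [sub_div, Finset.sum_div, sub_eq_add_neg]
      congr 1
      exact Finset.sum_congr rfl fun i _ => by ring
    simp only [Set.mem_preimage, Set.mem_ofPred_eq, this, Set.mem_Icc, ← abs_le]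
    rw [abs_div, abs_of_pos hr, div_le_one hr]
  have hcf : ∀ u : ℝ, |u| ≤ 1 → ‖charFun κ u‖ ≤ Real.exp (-b * u ^ 2) := fun u hu => by
    have e1 : ‖charFun κ u‖ = ∏ i, ‖charFun (ν i) (c i / r * u)‖ := by
      simp only [κ, κ₀]
      rw [charFun_map_add_const, norm_mul, charFun_map_linearForm, norm_prod]
      have : ‖Complex.exp (((inner ℝ (-(a / r)) u : ℝ) : ℂ) * Complex.I)‖ = 1 :=
        Complex.norm_exp_ofReal_mul_I _
      rw [this, mul_one]
    rw [e1]
    calc ∏ i, ‖charFun (ν i) (c i / r * u)‖ ≤ ∏ i, Real.exp (-((c i / r * u) ^ 2 / 512)) := by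
          refine Finset.prod_le_prod (fun i _ => norm_nonneg _) fun i _ =>
            (hν i).norm_charFun_le ?_
          rw [abs_mul, abs_div, abs_of_pos hr]
          have : |c i| / r ≤ 1 / 5 := by
            rw [div_le_div_iff₀ hr (by norm_num)]; linarith [hc i]
          calc |c i| / r * |u| ≤ 1 / 5 * 1 := by gcongr
            _ = 1 / 5 := by norm_num
      _ = Real.exp (-b * u ^ 2) := by
          rw [← Real.exp_sum]
          congr 1
          simp only [b, v]
          rw [Finset.sum_neg_distrib, Finset.sum_div, neg_mul, Finset.sum_mul]
          congr 1
          refine Finset.sum_congr rfl fun i _ => ?_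
          field_simp
  have hgauss : ∀ s : ℝ, ∫ t, Real.exp (-b * (t - s) ^ 2) ∂I ≤ √(Real.pi / b) := fun s => by
    rw [← integral_gaussian b, ← integral_sub_right_eq_self (fun x : ℝ => Real.exp (-b * x ^ 2)) s]
    refine integral_mono_measure Measure.restrict_le_self (ae_of_all _ fun x => (Real.exp_pos _).le)
      ((integrable_exp_neg_mul_sq hb).comp_sub_right s)
  have hInt : Integrable (fun p : ℝ × ℝ => Real.exp (-b * (p.1 - p.2) ^ 2)) (I.prod I) := by
    refine Integrable.of_bound (by fun_prop) 1 (ae_of_all _ fun p => ?_)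
    rw [Real.norm_eq_abs, Real.abs_exp, Real.exp_le_one_iff]
    nlinarith [sq_nonneg (p.1 - p.2)]
  have hmain : ∫ p : ℝ × ℝ, ‖charFun κ (p.1 - p.2)‖ ∂(I.prod I) ≤ √(Real.pi / b) := by
    calc _ ≤ ∫ p : ℝ × ℝ, Real.exp (-b * (p.1 - p.2) ^ 2) ∂(I.prod I) := by
          refine integral_mono_ae ?_ hInt ?_
          · refine Integrable.of_bound ?_ 1 (ae_of_all _ fun p => ?_)
            · exact ((measurable_charFun.comp
                (measurable_fst.sub measurable_snd)).norm).aestronglyMeasurable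
            · simpa using MeasureTheory.norm_charFun_le_one (μ := κ) (p.1 - p.2)
          · have : ∀ᵐ p ∂(I.prod I), p ∈ Set.Icc (0 : ℝ) 1 ×ˢ Set.Icc (0 : ℝ) 1 := by
              simp only [I]
              rw [Measure.prod_restrict]
              exact ae_restrict_mem (measurableSet_Icc.prod measurableSet_Icc)
            filter_upwards [this] with p hp
            refine hcf _ (abs_le.2 ⟨?_, ?_⟩) <;> linarith [hp.1.1, hp.1.2, hp.2.1, hp.2.2]
      _ = ∫ s, ∫ t, Real.exp (-b * (t - s) ^ 2) ∂I ∂I := integral_prod_symm _ hInt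
      _ ≤ ∫ s, √(Real.pi / b) ∂I := by
          refine integral_mono hInt.integral_prod_right (integrable_const _) fun s => hgauss s
      _ = √(Real.pi / b) := by simp
  have hval : √(Real.pi / b) ≤ 161 / 4 * (r / √v) := by
    have : Real.pi / b = 512 * Real.pi * (r / √v) ^ 2 := by
      rw [div_pow, Real.sq_sqrt hσ.le]
      simp only [b]
      field_simp
    rw [this, Real.sqrt_mul (by positivity), Real.sqrt_sq (by positivity)]
    gcongr
    rw [Real.sqrt_le_left (by norm_num)]
    nlinarith [Real.pi_lt_d2]
  rw [hset]
  have := measureReal_Icc_le_integral_charFun κ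
  linarith

end LinearForm

/-- Resampling one coordinate of a product measure does not change its law. -/
theorem MeasureTheory.measurePreserving_pi_update {ι : Type*} [Fintype ι] [DecidableEq ι]
    {X : ι → Type*} [∀ i, MeasurableSpace (X i)] (μ : ∀ i, Measure (X i))
    [∀ i, IsProbabilityMeasure (μ i)] (i : ι) :
    MeasurePreserving (fun p : (∀ j, X j) × X i => Function.update p.1 i p.2)
      ((Measure.pi μ).prod (μ i)) (Measure.pi μ) := by
  have hm : Measurable (fun p : (∀ j, X j) × X i => Function.update p.1 i p.2) := measurable_update'
  refine ⟨hm, (Measure.pi_eq fun s hs => ?_).symm⟩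
  rw [Measure.map_apply hm (MeasurableSet.univ_pi hs)]
  have : (fun p : (∀ j, X j) × X i => Function.update p.1 i p.2) ⁻¹' Set.univ.pi s =
      (Set.univ.pi (Function.update s i Set.univ)) ×ˢ s i := by
    ext p
    simp only [Set.mem_preimage, Set.mem_univ_pi, Set.mem_prod]
    constructor
    · intro h
      refine ⟨fun j => ?_, by simpa using h i⟩
      by_cases hj : j = i
      · subst hj; simp
      · simpa [hj] using h j
    · rintro ⟨h1, h2⟩ j
      by_cases hj : j = i
      · subst hj; simpa using h2
      · simpa [hj] using h1 j
  rw [this, Measure.prod_prod, Measure.pi_pi, ← Finset.mul_prod_erase _ _ (mem_univ i),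
    ← Finset.mul_prod_erase univ (fun j => μ j (s j)) (mem_univ i)]
  rw [mul_comm]
  simp only [Function.update_self, measure_univ, one_mul]
  congr 1
  refine Finset.prod_congr rfl fun j hj => ?_
  rw [Function.update_of_ne (Finset.ne_of_mem_erase hj)]

section LinearForm

variable {ι : Type*} [Fintype ι] {ν : ι → Measure ℝ}

/-- Conditioning on all coordinates but `j`, the density of `c j * x j` is at most `1 / |c j|`,
and the remaining terms must come within `2 |c j| + r` of the target. -/
theorem measureReal_abs_linearForm_sub_le_mul (hν : ∀ i, IsNiceLaw (ν i)) (c : ι → ℝ) (a : ℝ)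
    {r : ℝ} (hr : 0 < r) (j : ι) (hj : 0 < |c j|) :
    (Measure.pi ν).real {x | |∑ i, c i * x i - a| ≤ r} ≤
      2 * r / |c j| * (Measure.pi ν).real {x | |∑ i, c i * x i - a| ≤ 4 * |c j| + r} := by
  classical
  have := fun i => (hν i).isProbabilityMeasure
  set A : Set (ι → ℝ) := {x | |∑ i, c i * x i - a| ≤ r}
  set B : Set (ι → ℝ) := {x | |∑ i, c i * x i - a| ≤ 4 * |c j| + r}
  have hA : MeasurableSet A := measurableSet_le (by fun_prop) measurable_const
  have hB : MeasurableSet B := measurableSet_le (by fun_prop) measurable_const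
  have hbound : ∀ᵐ x ∂(Measure.pi ν), x j ∈ Set.Icc (-2 : ℝ) 2 :=
    (measurePreserving_eval ν j).quasiMeasurePreserving.ae (hν j).ae_mem_Icc
  have hupd : ∀ (x : ι → ℝ) (y : ℝ),
      ∑ i, c i * Function.update x j y i = ∑ i, c i * x i + c j * (y - x j) := fun x y => by
    rw [← Finset.add_sum_erase _ _ (mem_univ j),
      ← Finset.add_sum_erase univ (fun i => c i * x i) (mem_univ j)]
    have : ∑ i ∈ univ.erase j, c i * Function.update x j y i = ∑ i ∈ univ.erase j, c i * x i :=
      Finset.sum_congr rfl fun i hi => by rw [Function.update_of_ne (Finset.ne_of_mem_erase hi)]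
    rw [this, Function.update_self]
    ring
  have key : (Measure.pi ν) A ≤ ENNReal.ofReal (2 * r / |c j|) * (Measure.pi ν) B := by
    have hmp := measurePreserving_pi_update ν j
    rw [← hmp.measure_preimage hA.nullMeasurableSet, Measure.prod_apply (hmp.measurable hA)]
    calc _ ≤ ∫⁻ x, ENNReal.ofReal (2 * r / |c j|) * B.indicator 1 x ∂(Measure.pi ν) := by
          refine lintegral_mono_ae ?_
          filter_upwards [hbound] with x hx
          by_cases hxB : x ∈ B
          · rw [Set.indicator_of_mem hxB, Pi.one_apply, mul_one]
            set d := (a - ∑ i, c i * x i) / c j + x j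
            calc _ ≤ (ν j) (Set.Icc (d - r / |c j|) (d + r / |c j|)) := by
                  refine measure_mono fun y hy => ?_
                  have hy' : |∑ i, c i * x i + c j * (y - x j) - a| ≤ r := by
                    rw [← hupd]; exact hy
                  have e : ∑ i, c i * x i + c j * (y - x j) - a = c j * (y - d) := by
                    have : c j ≠ 0 := abs_pos.1 hj
                    simp only [d]
                    field_simp
                    ring
                  rw [e, abs_mul, mul_comm, ← le_div_iff₀ hj, abs_le] at hy'
                  exact ⟨by linarith [hy'.1], by linarith [hy'.2]⟩
              _ ≤ volume (Set.Icc (d - r / |c j|) (d + r / |c j|)) := (hν j).le_volume _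
              _ = _ := by
                  rw [Real.volume_Icc]
                  congr 1
                  ring
          · rw [Set.indicator_of_notMem hxB, mul_zero, nonpos_iff_eq_zero]
            refine measure_mono_null (fun y hy => ?_) (hν j).2.1
            intro hy2
            apply hxB
            have hy' : |∑ i, c i * x i + c j * (y - x j) - a| ≤ r := by
              rw [← hupd]; exact hy
            have h4 : |c j * (y - x j)| ≤ |c j| * 4 := by
              rw [abs_mul]
              gcongr
              exact abs_le.2 ⟨by linarith [hy2.1, hx.2], by linarith [hy2.2, hx.1]⟩
            show |∑ i, c i * x i - a| ≤ 4 * |c j| + r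
            have := abs_sub (∑ i, c i * x i + c j * (y - x j) - a) (c j * (y - x j))
            have e : ∑ i, c i * x i + c j * (y - x j) - a - c j * (y - x j) =
              ∑ i, c i * x i - a := by ring
            rw [e] at this
            linarith
      _ = _ := by
          rw [lintegral_const_mul _ (measurable_one.indicator hB), lintegral_indicator_one hB]
  have h2 := ENNReal.toReal_mono (by finiteness) key
  rwa [ENNReal.toReal_mul, ENNReal.toReal_ofReal (by positivity)] at h2

/-- **Rogozin's inequality** with an explicit constant. -/
theorem measureReal_abs_linearForm_sub_le_div_sqrt (hν : ∀ i, IsNiceLaw (ν i)) (c : ι → ℝ) (a : ℝ)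
    {r : ℝ} (hr : 0 < r) (hσ : 0 < ∑ i, c i ^ 2) :
    (Measure.pi ν).real {x | |∑ i, c i * x i - a| ≤ r} ≤ 2898 * (r / √(∑ i, c i ^ 2)) := by
  obtain ⟨i₀, -, hi₀⟩ := Finset.exists_ne_zero_of_sum_ne_zero hσ.ne'
  obtain ⟨j, -, hj⟩ := Finset.exists_max_image univ (fun i => |c i|) ⟨i₀, mem_univ _⟩
  have hj0 : 0 < |c j| :=
    lt_of_lt_of_le (abs_pos.2 fun h => hi₀ (by simp [h])) (hj i₀ (mem_univ _))
  have hs : 0 < √(∑ i, c i ^ 2) := Real.sqrt_pos.2 hσ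
  rcases le_total (5 * |c j|) r with h | h
  · refine (measureReal_abs_linearForm_sub_le hν c a hr
      (fun i => (mul_le_mul_of_nonneg_left (hj i (mem_univ _)) (by norm_num)).trans h) hσ).trans ?_
    gcongr
    norm_num
  · refine (measureReal_abs_linearForm_sub_le_mul hν c a hr j hj0).trans ?_
    have hle : (Measure.pi ν).real {x | |∑ i, c i * x i - a| ≤ 4 * |c j| + r} ≤
        161 * (9 * |c j| / √(∑ i, c i ^ 2)) := by
      have := fun i => (hν i).isProbabilityMeasure
      refine le_trans ?_ (measureReal_abs_linearForm_sub_le hν c a (r := 9 * |c j|)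
        (by positivity) (fun i => ?_) hσ)
      · refine measureReal_mono fun x hx => ?_
        have hx' : |∑ i, c i * x i - a| ≤ 4 * |c j| + r := hx
        exact hx'.trans (by linarith)
      · have : |c i| ≤ |c j| := hj i (mem_univ _)
        have := abs_nonneg (c j)
        linarith
    calc _ ≤ 2 * r / |c j| * (161 * (9 * |c j| / √(∑ i, c i ^ 2))) := by gcongr
      _ = _ := by field_simp; norm_num

theorem measureReal_half_le_linearForm (hν : ∀ i, IsNiceLaw (ν i)) (c : ι → ℝ) :
    (Measure.pi ν).real {x | 1 / 2 ≤ ∑ i, c i * x i} ≤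
      Real.exp (-(1 / (32 * ∑ i, c i ^ 2))) := by
  have := fun i => (hν i).isProbabilityMeasure
  have hindep : iIndepFun (fun i (x : ι → ℝ) => c i * x i) (Measure.pi ν) :=
    iIndepFun_pi (X := fun i (y : ℝ) => c i * y) fun i => by fun_prop
  have hsub : ∀ i ∈ univ, HasSubgaussianMGF (fun x : ι → ℝ => c i * x i)
      (⟨c i ^ 2, sq_nonneg _⟩ * (‖(2 : ℝ) - (-2)‖₊ / 2) ^ 2) (Measure.pi ν) := fun i _ => by
    have h1 := hasSubgaussianMGF_of_mem_Icc_of_integral_eq_zero (μ := ν i) (X := id)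
      aemeasurable_id (hν i).ae_mem_Icc (hν i).integral_id
    have h2 : HasSubgaussianMGF (id ∘ fun x : ι → ℝ => x i) ((‖(2 : ℝ) - (-2)‖₊ / 2) ^ 2)
        (Measure.pi ν) := by
      refine HasSubgaussianMGF.of_map (measurable_pi_apply i).aemeasurable ?_
      rwa [(measurePreserving_eval ν i).map_eq]
    exact h2.const_mul (c i)
  refine (HasSubgaussianMGF.measure_sum_ge_le_of_iIndepFun hindep hsub
    (by norm_num : (0 : ℝ) ≤ 1 / 2)).trans (le_of_eq ?_)
  congr 1
  have e : ((∑ i, (⟨c i ^ 2, sq_nonneg _⟩ * (‖(2 : ℝ) - (-2)‖₊ / 2) ^ 2) : NNReal) : ℝ) =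
      4 * ∑ i, c i ^ 2 := by
    push_cast
    rw [Finset.mul_sum]
    refine Finset.sum_congr rfl fun i _ => ?_
    change c i ^ 2 * (|(2 : ℝ) - (-2)| / 2) ^ 2 = _
    norm_num
    ring
  rw [e, neg_div]
  congr 1
  by_cases hz : ∑ i, c i ^ 2 = 0
  · simp [hz]
  · field_simp
    norm_num

/-- Linear anticoncentration. If the variance proxy `∑ c i ^ 2` is at least `1 / (32 log (1 / η))`
this is Rogozin's inequality, and otherwise the event already forces the linear form to be at
least `1 / 2`, which is unlikely by Hoeffding's inequality. -/
theorem measureReal_abs_linearForm_sub_one_le (hν : ∀ i, IsNiceLaw (ν i)) (c : ι → ℝ) {η : ℝ}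
    (hη : 0 < η) (hη' : η < 1 / 2) :
    (Measure.pi ν).real {x | |∑ i, c i * x i - 1| ≤ η} ≤ 20000 * η * √(Real.logb 2 (1 / η)) := by
  have := fun i => (hν i).isProbabilityMeasure
  set v := ∑ i, c i ^ 2
  have hv : 0 ≤ v := Finset.sum_nonneg fun i _ => sq_nonneg _
  have hlog : 1 < Real.logb 2 (1 / η) := by
    rw [Real.lt_logb_iff_rpow_lt (by norm_num) (by positivity), Real.rpow_one,
      lt_div_iff₀ hη]
    linarith
  have hln : Real.log (1 / η) ≤ Real.logb 2 (1 / η) := by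
    have h2 : Real.log 2 ≤ 1 := by linarith [Real.log_two_lt_d9]
    have h0 : 0 ≤ Real.log (1 / η) :=
      Real.log_nonneg (by rw [le_div_iff₀ hη]; linarith)
    exact le_div_self h0 (Real.log_pos (by norm_num)) h2
  have hln0 : 0 < Real.log (1 / η) := Real.log_pos (by rw [lt_div_iff₀ hη]; linarith)
  have hsq : 1 ≤ √(Real.logb 2 (1 / η)) := Real.one_le_sqrt.2 hlog.le
  rcases le_or_gt 1 (32 * v * Real.log (1 / η)) with h | h
  · have hv0 : 0 < v := by
      by_contra h0
      have : v = 0 := le_antisymm (not_lt.1 h0) hv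
      rw [this] at h
      norm_num at h
    refine (measureReal_abs_linearForm_sub_le_div_sqrt hν c 1 hη hv0).trans ?_
    have h1 : 1 / √v ≤ 6 * √(Real.logb 2 (1 / η)) := by
      rw [div_le_iff₀ (Real.sqrt_pos.2 hv0), mul_assoc, ← Real.sqrt_mul (by linarith)]
      have : 1 / 6 ≤ √(Real.logb 2 (1 / η) * v) := by
        apply Real.le_sqrt_of_sq_le
        nlinarith
      linarith
    calc 2898 * (η / √v) = 2898 * η * (1 / √v) := by ring
      _ ≤ 2898 * η * (6 * √(Real.logb 2 (1 / η))) := by gcongr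
      _ ≤ _ := by nlinarith [mul_pos hη (lt_of_lt_of_le one_pos hsq)]
  · rcases hv.eq_or_lt with hv0 | hv0
    · have hc : ∀ i, c i = 0 := fun i => by
        have := (Finset.sum_eq_zero_iff_of_nonneg fun i _ => sq_nonneg (c i)).1 hv0.symm i
          (mem_univ i)
        exact pow_eq_zero_iff (two_ne_zero) |>.1 this
      have : {x : ι → ℝ | |∑ i, c i * x i - 1| ≤ η} = ∅ := by
        ext x
        simp only [hc, zero_mul, Finset.sum_const_zero, Set.mem_ofPred_eq, Set.mem_empty_iff_false,
          iff_false]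
        norm_num
        linarith
      rw [this]
      simp only [measureReal_empty]
      positivity
    · have h1 : (Measure.pi ν).real {x | |∑ i, c i * x i - 1| ≤ η} ≤ η := by
        calc _ ≤ (Measure.pi ν).real {x | 1 / 2 ≤ ∑ i, c i * x i} := by
              refine measureReal_mono fun x hx => ?_
              have hx' : |∑ i, c i * x i - 1| ≤ η := hx
              have := (abs_le.1 hx').1
              show 1 / 2 ≤ ∑ i, c i * x i
              linarith
          _ ≤ Real.exp (-(1 / (32 * v))) := measureReal_half_le_linearForm hν c
          _ ≤ Real.exp (-Real.log (1 / η)) := by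
              gcongr
              rw [le_div_iff₀ (by positivity)]
              linarith
          _ = η := by
              rw [one_div, Real.log_inv, neg_neg, Real.exp_log hη]
      refine h1.trans ?_
      nlinarith

end LinearForm

theorem isAnticoncentrationConstant_20000 : IsAnticoncentrationConstant 20000 :=
  ⟨by norm_num, fun _ _ hν c _ hη hη' => measureReal_abs_linearForm_sub_one_le hν c hη hη'⟩

/-! ### Random equipartitions -/

section Equipartition

variable {E : Type} {t : ℕ}

theorem shatters_iff_injOn {π : E → Fin t} {F : Finset E} :
    Shatters π F ↔ Set.InjOn π (F : Set E) := by
  constructor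
  · intro h a ha b hb hab
    exact Finset.card_le_one.1 (h (π b)) a (by simpa [hab] using ha) b (by simpa using hb)
  · intro h j
    refine Finset.card_le_one.2 fun a ha b hb => ?_
    rw [mem_filter] at ha hb
    exact h ha.1 hb.1 (ha.2.trans hb.2.symm)

theorem Shatters.mono {π : E → Fin t} {F F' : Finset E} (h : Shatters π F') (hF : F ⊆ F') :
    Shatters π F :=
  shatters_iff_injOn.2 ((shatters_iff_injOn.1 h).mono hF)

variable [Fintype E]

instance : DecidablePred (IsEquipartition (E := E) (t := t)) := fun π =>
  inferInstanceAs (Decidable (∀ i j : Fin t,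
    (univ.filter (fun e => π e = i)).card ≤ (univ.filter (fun e => π e = j)).card + 1))

theorem sum_card_fiber (π : E → Fin t) :
    ∑ i, (univ.filter fun e => π e = i).card = Fintype.card E :=
  (Finset.card_eq_sum_card_fiberwise fun e _ => mem_coe.2 (mem_univ (π e))).symm

theorem IsEquipartition.le_card_fiber {π : E → Fin t} (h : IsEquipartition π) (i : Fin t) :
    Fintype.card E / t ≤ (univ.filter fun e => π e = i).card := by
  have ht : 0 < t := i.pos
  by_contra! hlt
  have h1 : Fintype.card E < t * (Fintype.card E / t) := by
    conv_lhs => rw [← sum_card_fiber π]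
    calc ∑ j, (univ.filter fun e => π e = j).card < ∑ j : Fin t, Fintype.card E / t :=
          Finset.sum_lt_sum (fun j _ => (h j i).trans hlt) ⟨i, mem_univ _, hlt⟩
      _ = t * (Fintype.card E / t) := by simp
  exact absurd (Nat.mul_div_le (Fintype.card E) t) (not_le.2 h1)

theorem IsEquipartition.card_fiber_le {π : E → Fin t} (h : IsEquipartition π) (i : Fin t) :
    (univ.filter fun e => π e = i).card ≤ Fintype.card E / t + 1 := by
  have ht : 0 < t := i.pos
  by_contra! hlt
  have h1 : t * (Fintype.card E / t + 1) < Fintype.card E := by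
    conv_rhs => rw [← sum_card_fiber π]
    calc t * (Fintype.card E / t + 1) = ∑ j : Fin t, (Fintype.card E / t + 1) := by simp
      _ < ∑ j, (univ.filter fun e => π e = j).card :=
          Finset.sum_lt_sum (fun j _ => by have := h i j; omega) ⟨i, mem_univ _, hlt⟩
  exact absurd (Nat.lt_mul_div_succ (Fintype.card E) ht) (not_lt.2 h1.le)

/-- An equipartition has at least as many transversals, up to normalization, as there are
injections of the labels: pair the `i`-th factor of the falling factorial with a part. -/
theorem IsEquipartition.descFactorial_le {π : E → Fin t} (h : IsEquipartition π) :
    (Fintype.card E).descFactorial t ≤ t ^ t * ∏ i, (univ.filter fun e => π e = i).card := by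
  rcases Nat.eq_zero_or_pos t with rfl | ht
  · simp
  set M := Fintype.card E with hM
  set q := Fintype.card E / t with hq
  set big := univ.filter fun i : Fin t => (univ.filter fun e => π e = i).card = q + 1 with hbig
  have hsize : ∀ i, (univ.filter fun e => π e = i).card = if i ∈ big then q + 1 else q := by
    intro i
    have h1 := h.le_card_fiber i
    have h2 := h.card_fiber_le i
    split_ifs with hi
    · exact (mem_filter.1 hi).2
    · have : (univ.filter fun e => π e = i).card ≠ q + 1 := fun h' =>
        hi (mem_filter.2 ⟨mem_univ _, h'⟩)
      omega
  have hMq : M = t * q + big.card := by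
    rw [hM, ← sum_card_fiber π]
    simp only [hsize]
    have : ∀ i : Fin t, (if i ∈ big then q + 1 else q) = q + if i ∈ big then 1 else 0 := fun i => by
      split_ifs <;> rfl
    simp only [this, Finset.sum_add_distrib]
    simp
  have hbt : big.card ≤ t := by simpa using card_le_univ big
  have e1 : t ^ t * ∏ i, (univ.filter fun e => π e = i).card =
      (t * (q + 1)) ^ big.card * (t * q) ^ (t - big.card) := by
    simp only [hsize]
    rw [Finset.prod_ite, Finset.prod_const, Finset.prod_const]
    have a1 : (univ.filter fun i => i ∈ big) = big := by ext; simp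
    have a2 : (univ.filter fun i => i ∉ big).card = t - big.card := by
      rw [← Finset.compl_filter, card_compl, a1, Fintype.card_fin]
    rw [a1, a2, mul_pow, mul_pow]
    conv_lhs => rw [show t ^ t = t ^ big.card * t ^ (t - big.card) by
      rw [← pow_add]; congr 1; omega]
    ring
  have e2 : (t * (q + 1)) ^ big.card * (t * q) ^ (t - big.card) =
      ∏ i ∈ range t, if i < big.card then t * (q + 1) else t * q := by
    rw [Finset.prod_ite, Finset.prod_const, Finset.prod_const]
    have a1 : (range t).filter (fun i => i < big.card) = range big.card := by
      ext i; simp only [mem_filter, mem_range]; omega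
    have a2 : ((range t).filter fun i => ¬ i < big.card).card = t - big.card := by
      have := Finset.card_filter_add_card_filter_not (s := range t) (fun i => i < big.card)
      rw [a1] at this
      simp only [card_range] at this
      omega
    rw [a1, a2, card_range]
  rw [e1, e2, Nat.descFactorial_eq_prod_range]
  refine Finset.prod_le_prod' fun i hi => ?_
  split_ifs with hib
  · rw [mul_add, mul_one]; omega
  · omega

theorem IsEquipartition.comp_perm {π : E → Fin t} (h : IsEquipartition π) (σ : Equiv.Perm E) :
    IsEquipartition (π ∘ σ) := by
  have key : ∀ i, (univ.filter fun e => (π ∘ σ) e = i).card = (univ.filter fun e => π e = i).card :=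
    fun i => Finset.card_bij (fun e _ => σ e) (fun e he => by simpa using he)
      (fun a _ b _ hab => σ.injective hab)
      fun b hb => ⟨σ.symm b, by simpa using hb, by simp⟩
  intro i j
  rw [key, key]
  exact h i j

variable [DecidableEq E]

variable (E) in
/-- The equipartitions of `E` into `t` labelled parts. -/
def equipartitions (t : ℕ) : Finset (E → Fin t) := univ.filter IsEquipartition

/-- The equipartitions that shatter `F`. -/
def shattering (t : ℕ) (F : Finset E) : Finset (E → Fin t) :=
  (equipartitions E t).filter fun π => Shatters π F

variable (E) in
theorem exists_isEquipartition (ht : 0 < t) : ∃ π : E → Fin t, IsEquipartition π := by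
  have key : ∀ s : Finset E, ∃ π : E → Fin t, ∀ i j : Fin t,
      (s.filter fun e => π e = i).card ≤ (s.filter fun e => π e = j).card + 1 := by
    intro s
    induction s using Finset.induction_on with
    | empty => exact ⟨fun _ => ⟨0, ht⟩, by simp⟩
    | insert a s ha ih =>
      obtain ⟨π, hπ⟩ := ih
      obtain ⟨m, -, hm⟩ := Finset.exists_min_image univ
        (fun i => (s.filter fun e => π e = i).card) ⟨⟨0, ht⟩, mem_univ _⟩
      refine ⟨Function.update π a m, ?_⟩
      have hcard : ∀ i, ((insert a s).filter fun e => Function.update π a m e = i).card =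
          (s.filter fun e => π e = i).card + if i = m then 1 else 0 := by
        intro i
        have h1 : (s.filter fun e => Function.update π a m e = i) =
            s.filter fun e => π e = i := by
          refine Finset.filter_congr fun e he => ?_
          rw [Function.update_of_ne (ne_of_mem_of_not_mem he ha)]
        rw [Finset.filter_insert, h1, Function.update_self]
        by_cases h : m = i
        · simp [h, ha]
        · simp [h, Ne.symm h]
      intro i j
      rw [hcard, hcard]
      have h1 := hπ i j
      have h2 := hm j (mem_univ _)
      split_ifs with hi hj
      · subst hi; subst hj; omega
      · subst hi; omega
      · omega
      · omega
  exact key univ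

/-- All sets of the same size are equally likely to be shattered. -/
theorem card_shattering_eq {F F' : Finset E} (h : F.card = F'.card) :
    (shattering t F).card = (shattering t F').card := by
  obtain ⟨σ, hσ⟩ : ∃ σ : Equiv.Perm E, F.map σ.toEmbedding = F' := by
    let e : {x // x ∈ F} ≃ {x // x ∈ F'} := Finset.equivOfCardEq h
    refine ⟨e.extendSubtype, ?_⟩
    apply Finset.eq_of_subset_of_card_le
    · intro x hx
      obtain ⟨y, hy, rfl⟩ := Finset.mem_map.1 hx
      have := e.extendSubtype_mem y hy
      exact this
    · rw [Finset.card_map, h]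
  have key : ∀ (σ : Equiv.Perm E) (F F' : Finset E), F.map σ.toEmbedding = F' →
      (shattering t F').card ≤ (shattering t F).card := by
    rintro σ F _ rfl
    refine Finset.card_le_card_of_injOn (fun π => π ∘ σ) (fun π hπ => ?_) (fun π _ π' _ hh => ?_)
    · simp only [shattering, equipartitions, coe_filter, mem_filter, mem_univ, true_and,
        Set.mem_ofPred_eq] at hπ ⊢
      refine ⟨hπ.1.comp_perm σ, shatters_iff_injOn.2 ?_⟩
      have := shatters_iff_injOn.1 hπ.2
      intro a ha b hb hab
      exact σ.injective (this (by simpa using ha) (by simpa using hb) hab)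
    · ext e
      have := congrFun hh (σ.symm e)
      simp only [Function.comp_apply, Equiv.apply_symm_apply] at this
      rw [this]
  refine le_antisymm (key σ.symm F' F ?_) (key σ F F' hσ)
  rw [← hσ, Finset.map_map]
  ext x
  simp

/-- A partition has at least as many transversals as there are choices of one element per part. -/
theorem prod_card_fiber_le_card_transversals (π : E → Fin t) :
    ∏ i, (univ.filter fun e => π e = i).card ≤
      ((powersetCard t univ).filter fun F : Finset E => Shatters π F).card := by
  rw [← Fintype.card_piFinset]
  have hsec : ∀ g ∈ Fintype.piFinset (fun i => univ.filter fun e => π e = i), ∀ i, π (g i) = i :=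
    fun g hg i => by simpa using Fintype.mem_piFinset.1 hg i
  refine Finset.card_le_card_of_injOn (fun g => univ.image g) (fun g hg => ?_)
    (fun g hg g' hg' hh => ?_)
  · have hs := hsec g hg
    have hinj : Function.Injective g := fun i j hij => by rw [← hs i, ← hs j, hij]
    simp only [coe_filter, Set.mem_ofPred_eq, mem_powersetCard]
    refine ⟨⟨subset_univ _, by rw [card_image_of_injective _ hinj]; simp⟩,
      shatters_iff_injOn.2 fun a ha b hb hab => ?_⟩
    obtain ⟨i, -, rfl⟩ := Finset.mem_image.1 ha
    obtain ⟨j, -, rfl⟩ := Finset.mem_image.1 hb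
    rw [hs, hs] at hab
    rw [hab]
  · have hs := hsec g hg
    have hs' := hsec g' hg'
    ext i
    have : g i ∈ univ.image g' := by
      have h1 : univ.image g = univ.image g' := hh
      rw [← h1]
      exact mem_image_of_mem _ (mem_univ _)
    obtain ⟨j, -, hj⟩ := Finset.mem_image.1 this
    have : j = i := by rw [← hs' j, hj, hs i]
    rw [← hj, this]

/-- A set of `t` elements is shattered with probability at least `t! / t ^ t`. -/
theorem factorial_mul_card_equipartitions_le {F : Finset E} (hF : F.card = t) :
    t.factorial * (equipartitions E t).card ≤ t ^ t * (shattering t F).card := by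
  have hchoose : 0 < (Fintype.card E).choose t := Nat.choose_pos (hF ▸ card_le_univ F)
  have hdouble : (Fintype.card E).choose t * (shattering t F).card =
      ∑ π ∈ equipartitions E t, ((powersetCard t univ).filter fun F => Shatters π F).card := by
    have h1 := Finset.sum_card_bipartiteAbove_eq_sum_card_bipartiteBelow
      (s := powersetCard t (univ : Finset E)) (t := equipartitions E t)
      (r := fun F π => Shatters π F)
    simp only [bipartiteAbove, bipartiteBelow] at h1
    rw [← h1]
    have h2 : ∀ F' ∈ powersetCard t (univ : Finset E),
        ((equipartitions E t).filter fun π => _root_.Shatters π F').card =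
          (shattering t F).card :=
      fun F' hF' => card_shattering_eq (by rw [(mem_powersetCard.1 hF').2, hF])
    rw [Finset.sum_congr rfl h2]
    simp
  refine le_of_mul_le_mul_left (a := (Fintype.card E).choose t) ?_ hchoose
  calc (Fintype.card E).choose t * (t.factorial * (equipartitions E t).card)
      = ∑ π ∈ equipartitions E t, (Fintype.card E).descFactorial t := by
        rw [Finset.sum_const, smul_eq_mul, Nat.descFactorial_eq_factorial_mul_choose]
        ring
    _ ≤ ∑ π ∈ equipartitions E t,
          t ^ t * ((powersetCard t univ).filter fun F => Shatters π F).card := by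
        refine Finset.sum_le_sum fun π hπ => ?_
        refine (IsEquipartition.descFactorial_le (mem_filter.1 hπ).2).trans ?_
        gcongr
        exact prod_card_fiber_le_card_transversals π
    _ = _ := by
        rw [← Finset.mul_sum, ← hdouble]
        ring

theorem exp_neg_mul_card_equipartitions_le {F : Finset E} (hF : F.card = t) :
    Real.exp (-t) * (equipartitions E t).card ≤ (shattering t F).card := by
  have h1 : ((t.factorial * (equipartitions E t).card : ℕ) : ℝ) ≤
      ((t ^ t * (shattering t F).card : ℕ) : ℝ) :=
    Nat.cast_le.2 (factorial_mul_card_equipartitions_le hF)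
  push_cast at h1
  have h2 : (t : ℝ) ^ t ≤ Real.exp t * t.factorial := by
    have := Real.pow_div_factorial_le_exp (t : ℝ) (Nat.cast_nonneg t) t
    rwa [div_le_iff₀ (by positivity)] at this
  have h3 : (0 : ℝ) < t.factorial := by positivity
  rw [Real.exp_neg, inv_mul_le_iff₀ (Real.exp_pos _)]
  refine le_of_mul_le_mul_left (a := (t.factorial : ℝ)) ?_ h3
  calc _ ≤ (t : ℝ) ^ t * (shattering t F).card := h1
    _ ≤ (Real.exp t * t.factorial) * (shattering t F).card := by gcongr
    _ = _ := by ring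

/-- For distinct sets `F`, `F'` of `t` elements, the conditional probability that `F'` is shattered
given that `F` is shattered is of order `1 / t`: when both are, an element `f` of `F' \ F` must have received the one label that the rest of `F'`
leaves free. The proof swaps `f` with the elements outside of `F ∪ F'`. -/
theorem card_shattering_inter_mul_le {F F' : Finset E} (hF : F.card = t) (hF' : F'.card = t)
    (hne : F ≠ F') :
    (shattering t F ∩ shattering t F').card * (Fintype.card E - 2 * t) ≤
      (shattering t F).card * (Fintype.card E / t + 1) := by
  obtain ⟨f, hfF', hfF⟩ : ∃ f ∈ F', f ∉ F := by
    by_contra! h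
    exact hne (Finset.eq_of_subset_of_card_le h (by rw [hF, hF'])).symm
  set out := (univ : Finset E) \ (F ∪ F')
  have hout : Fintype.card E - 2 * t ≤ out.card := by
    rw [Finset.card_sdiff_of_subset (subset_univ _), card_univ]
    have := card_union_le F F'
    omega
  -- pairs `(π, e)` such that `e` has a label missed by `F'` without `f`; that label is unique
  set target := (shattering t F).sigma fun π : E → Fin t =>
    univ.filter fun e : E => Set.InjOn π (F'.erase f : Set E) ∧ π e ∉ (F'.erase f).image π
  have h1 : (shattering t F ∩ shattering t F').card * out.card ≤ target.card := by
    rw [← Finset.card_product]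
    refine Finset.card_le_card_of_injOn
      (fun p => ⟨p.1 ∘ Equiv.swap f p.2, p.2⟩) (fun p hp => ?_) (fun p hp p' hp' hh => ?_)
    · obtain ⟨hp1, hp2⟩ := Finset.mem_product.1 (mem_coe.1 hp)
      obtain ⟨hpF, hpF'⟩ := Finset.mem_inter.1 hp1
      have hpe : p.2 ∉ F ∧ p.2 ∉ F' := by simpa [out] using hp2
      simp only [shattering, equipartitions, mem_filter, mem_univ, true_and] at hpF hpF'
      have hfix : ∀ x ∈ F, Equiv.swap f p.2 x = x := fun x hx =>
        Equiv.swap_apply_of_ne_of_ne (fun h => hfF (h ▸ hx)) (fun h => hpe.1 (h ▸ hx))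
      have hfix' : ∀ x ∈ F'.erase f, Equiv.swap f p.2 x = x := fun x hx =>
        Equiv.swap_apply_of_ne_of_ne (Finset.ne_of_mem_erase hx)
          (fun h => hpe.2 (h ▸ Finset.mem_of_mem_erase hx))
      have hinj := shatters_iff_injOn.1 hpF.2
      have hinj' := shatters_iff_injOn.1 hpF'.2
      simp only [target, shattering, equipartitions, mem_coe, mem_sigma, mem_filter, mem_univ,
        true_and]
      refine ⟨⟨hpF.1.comp_perm _, shatters_iff_injOn.2 fun a ha b hb hab => ?_⟩,
        fun a ha b hb hab => ?_, fun hmem => ?_⟩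
      · simp only [Function.comp_apply, hfix a ha, hfix b hb] at hab
        exact hinj ha hb hab
      · simp only [Function.comp_apply, hfix' a ha, hfix' b hb] at hab
        exact hinj' (Finset.mem_of_mem_erase ha) (Finset.mem_of_mem_erase hb) hab
      · obtain ⟨x, hx, hxe⟩ := Finset.mem_image.1 hmem
        simp only [Function.comp_apply, hfix' x hx, Equiv.swap_apply_right] at hxe
        exact Finset.ne_of_mem_erase hx (hinj' (Finset.mem_of_mem_erase hx) hfF' hxe)
    · obtain ⟨ha, hb⟩ := Sigma.mk.inj_iff.1 hh
      have hb : p.2 = p'.2 := eq_of_heq hb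
      have ha : p.1 ∘ Equiv.swap f p.2 = p'.1 ∘ Equiv.swap f p'.2 := ha
      rw [← hb] at ha
      refine Prod.ext (funext fun x => ?_) hb
      have := congrFun ha (Equiv.swap f p.2 x)
      simp only [Function.comp_apply, Equiv.swap_apply_self] at this
      exact this
  have h2 : target.card ≤ (shattering t F).card * (Fintype.card E / t + 1) := by
    rw [Finset.card_sigma]
    refine Finset.sum_le_card_nsmul _ _ _ fun π hπ => ?_
    by_cases hinj : Set.InjOn π (F'.erase f : Set E)
    · have hcompl : ((F'.erase f).image π)ᶜ.card = 1 := by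
        rw [card_compl, Finset.card_image_of_injOn hinj, card_erase_of_mem hfF', hF',
          Fintype.card_fin]
        have : 0 < t := hF' ▸ card_pos.2 ⟨f, hfF'⟩
        omega
      obtain ⟨a, ha⟩ := Finset.card_eq_one.1 hcompl
      have heq : (IsEquipartition π) := (mem_filter.1 (mem_filter.1 hπ).1).2
      refine le_trans (card_le_card fun e he => ?_) (heq.card_fiber_le a)
      have : π e ∈ ((F'.erase f).image π)ᶜ := mem_compl.2 (mem_filter.1 he).2.2
      rw [ha, mem_singleton] at this
      simpa using this
    · have h0 : (univ.filter fun e : E =>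
          Set.InjOn π (F'.erase f : Set E) ∧ π e ∉ (F'.erase f).image π) = ∅ :=
        Finset.filter_eq_empty_iff.2 fun e _ h => hinj h.1
      exact (card_eq_zero.2 h0).trans_le (Nat.zero_le _)
  exact (Nat.mul_le_mul_left _ hout).trans (h1.trans h2)

end Equipartition

section Equipartition

variable {E : Type} [Fintype E] [DecidableEq E]

/-- The expected number of pairs of members of `𝒞` whose extensions `ext` to `2 T` elements are both
shattered: pairs with a common extension are rare, and any other pair costs a factor `1 / T`. -/
theorem mul_sum_card_shattered_sq_le {T : ℕ} (hT : 0 < T) {𝒞 : Finset (Finset E)}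
    {ext : Finset E → Finset E} (hsub : ∀ F ∈ 𝒞, F ⊆ ext F) (hext : ∀ F ∈ 𝒞, (ext F).card = 2 * T)
    (hE : 10 * T ≤ Fintype.card E) {a : ℕ}
    (ha : ∀ F ∈ 𝒞, (shattering (2 * T) (ext F)).card = a) :
    T * ∑ π ∈ equipartitions E (2 * T),
        (𝒞.filter fun F => _root_.Shatters π (ext F)).card ^ 2 ≤
      𝒞.card * a * (T * 4 ^ T + 𝒞.card) := by
  have hsq : ∑ π ∈ equipartitions E (2 * T),
        (𝒞.filter fun F => _root_.Shatters π (ext F)).card ^ 2 =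
      ∑ F ∈ 𝒞, ∑ F' ∈ 𝒞,
        (shattering (2 * T) (ext F) ∩ shattering (2 * T) (ext F')).card := by
    have h1 : ∀ π : E → Fin (2 * T), (𝒞.filter fun F => _root_.Shatters π (ext F)).card ^ 2 =
        ∑ F ∈ 𝒞, ∑ F' ∈ 𝒞,
          if _root_.Shatters π (ext F) ∧ _root_.Shatters π (ext F') then 1 else 0 := fun π => by
      rw [sq, card_filter, Finset.sum_mul_sum]
      refine Finset.sum_congr rfl fun F _ => Finset.sum_congr rfl fun F' _ => ?_
      by_cases h1 : _root_.Shatters π (ext F) <;> by_cases h2 : _root_.Shatters π (ext F') <;>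
        simp [h1, h2]
    simp only [h1]
    rw [Finset.sum_comm]
    refine Finset.sum_congr rfl fun F _ => ?_
    rw [Finset.sum_comm]
    refine Finset.sum_congr rfl fun F' _ => ?_
    rw [← card_filter]
    congr 1
    ext π
    simp only [shattering, mem_filter, mem_inter]
    tauto
  have hinter : ∀ F ∈ 𝒞, ∀ F' ∈ 𝒞, ext F ≠ ext F' →
      T * (shattering (2 * T) (ext F) ∩ shattering (2 * T) (ext F')).card ≤ a := by
    intro F hF F' hF' hne
    have h1 := card_shattering_inter_mul_le (hext F hF) (hext F' hF') hne
    rw [ha F hF] at h1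
    set M := Fintype.card E
    set q := M / (2 * T) with hq
    have hq5 : 5 ≤ q := by
      rw [hq, Nat.le_div_iff_mul_le (by omega)]
      omega
    have h2 : T * (q + 1) ≤ M - 2 * (2 * T) := by
      have h3 : 2 * T * q ≤ M := Nat.mul_div_le M (2 * T)
      have h4 : T * (q + 1) + 2 * (2 * T) ≤ 2 * T * q := by nlinarith
      omega
    have h5 : 0 < M - 2 * (2 * T) := by omega
    refine le_of_mul_le_mul_right ?_ h5
    calc _ = T * ((shattering (2 * T) (ext F) ∩ shattering (2 * T) (ext F')).card *
          (M - 2 * (2 * T))) := by ring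
      _ ≤ T * (a * (q + 1)) := Nat.mul_le_mul_left _ h1
      _ = a * (T * (q + 1)) := by ring
      _ ≤ _ := Nat.mul_le_mul_left _ h2
  rw [hsq, Finset.mul_sum, mul_assoc, ← smul_eq_mul (a := 𝒞.card)]
  refine Finset.sum_le_card_nsmul _ _ _ fun F hF => ?_
  rw [Finset.mul_sum, ← Finset.sum_filter_add_sum_filter_not 𝒞 (fun F' => ext F = ext F')]
  have hsame : ∑ F' ∈ 𝒞.filter (fun F' => ext F = ext F'),
      T * (shattering (2 * T) (ext F) ∩ shattering (2 * T) (ext F')).card ≤ 4 ^ T * (T * a) := by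
    refine (Finset.sum_le_card_nsmul _ _ (T * a) fun F' hF' => ?_).trans ?_
    · refine Nat.mul_le_mul_left _ ?_
      rw [← ha F hF]
      exact card_le_card inter_subset_left
    · rw [smul_eq_mul]
      refine Nat.mul_le_mul_right _ ?_
      have h1 : 𝒞.filter (fun F' => ext F = ext F') ⊆ (ext F).powerset := fun F' hF' => by
        rw [mem_filter] at hF'
        rw [mem_powerset, hF'.2]
        exact hsub F' hF'.1
      calc _ ≤ _ := card_le_card h1
        _ = 4 ^ T := by rw [card_powerset, hext F hF, pow_mul]; norm_num
  have hdiff : ∑ F' ∈ 𝒞.filter (fun F' => ¬ ext F = ext F'),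
      T * (shattering (2 * T) (ext F) ∩ shattering (2 * T) (ext F')).card ≤ 𝒞.card * a := by
    refine (Finset.sum_le_card_nsmul _ _ a fun F' hF' => ?_).trans ?_
    · rw [mem_filter] at hF'
      exact hinter F hF F' hF'.1 hF'.2
    · rw [smul_eq_mul]
      exact Nat.mul_le_mul_right _ (card_filter_le _ _)
  calc _ ≤ 4 ^ T * (T * a) + 𝒞.card * a := add_le_add hsame hdiff
    _ = _ := by ring

/-- A random equipartition shatters many members of a large family `𝒞` with probability at least
`0.4 T exp (-2 T)`. The expected number alone would give only `exp (-2 T)`, with the extra factor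
`T` coming from the second moment. -/
theorem mul_exp_neg_mul_card_equipartitions_le {T : ℕ} (hT : 0 < T) {𝒞 : Finset (Finset E)}
    (h𝒞 : ∀ F ∈ 𝒞, F.card ≤ 2 * T) (hlarge : 2 ^ (10 * T) ≤ 𝒞.card) {s : ℝ} (hs0 : 0 ≤ s)
    (hs : 10 * s ≤ 𝒞.card * (0.1 : ℝ) ^ T) :
    0.4 * T * Real.exp (-(2 * T)) * (equipartitions E (2 * T)).card ≤
      ((equipartitions E (2 * T)).filter
        fun π => s ≤ ((shatteredPart 𝒞 π).card : ℝ)).card := by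
  have hE : 10 * T ≤ Fintype.card E := by
    have h1 : 𝒞.card ≤ 2 ^ Fintype.card E := by
      rw [← Fintype.card_finset]
      exact card_le_univ _
    exact (Nat.pow_le_pow_iff_right (by norm_num)).1 (hlarge.trans h1)
  have hex : ∀ F : Finset E, ∃ F' : Finset E, F ∈ 𝒞 → F ⊆ F' ∧ F'.card = 2 * T := fun F => by
    by_cases hF : F ∈ 𝒞
    · obtain ⟨F', h1, h2⟩ := Finset.exists_superset_card_eq (h𝒞 F hF)
        (by omega : 2 * T ≤ Fintype.card E)
      exact ⟨F', fun _ => ⟨h1, h2⟩⟩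
    · exact ⟨F, fun h => absurd h hF⟩
  choose ext hext using hex
  have h𝒞0 : 0 < 𝒞.card := lt_of_lt_of_le (by positivity) hlarge
  obtain ⟨F₀, hF₀⟩ := Finset.card_pos.1 h𝒞0
  set a := (shattering (2 * T) (ext F₀)).card with ha_def
  have ha : ∀ F ∈ 𝒞, (shattering (2 * T) (ext F)).card = a := fun F hF =>
    card_shattering_eq (by rw [(hext F hF).2, (hext F₀ hF₀).2])
  set Q := equipartitions E (2 * T)
  set X : (E → Fin (2 * T)) → ℕ := fun π => (𝒞.filter fun F => _root_.Shatters π (ext F)).card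
  have hsum : ∑ π ∈ Q, X π = 𝒞.card * a := by
    have h1 := Finset.sum_card_bipartiteAbove_eq_sum_card_bipartiteBelow
      (s := Q) (t := 𝒞) (r := fun π F => _root_.Shatters π (ext F))
    simp only [bipartiteAbove, bipartiteBelow] at h1
    simp only [X]
    rw [h1]
    exact (Finset.sum_congr rfl ha).trans (by simp)
  have hsq : (T : ℝ) * ∑ π ∈ Q, (X π : ℝ) ^ 2 ≤ 2 * a * (𝒞.card : ℝ) ^ 2 := by
    have h1 := mul_sum_card_shattered_sq_le hT (fun F hF => (hext F hF).1)
      (fun F hF => (hext F hF).2) hE ha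
    have h2 : T * 4 ^ T ≤ 𝒞.card := by
      refine le_trans ?_ hlarge
      calc T * 4 ^ T ≤ 2 ^ T * 4 ^ T := by gcongr; exact T.lt_two_pow_self.le
        _ = 2 ^ (3 * T) := by rw [← mul_pow, pow_mul]; norm_num
        _ ≤ 2 ^ (10 * T) := by gcongr <;> omega
    have h3 : 𝒞.card * a * (T * 4 ^ T + 𝒞.card) ≤ 2 * a * 𝒞.card ^ 2 := by
      calc _ ≤ 𝒞.card * a * (𝒞.card + 𝒞.card) := by gcongr
        _ = _ := by ring
    exact_mod_cast h1.trans h3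
  have haQ : Real.exp (-(2 * T)) * Q.card ≤ a := by
    have := exp_neg_mul_card_equipartitions_le (hext F₀ hF₀).2
    push_cast at this
    exact this
  have h01 : (0.1 : ℝ) ^ T ≤ Real.exp (-(2 * T)) := by
    have h2 : (0.1 : ℝ) ≤ Real.exp (-2) := by
      rw [Real.exp_neg, show (2 : ℝ) = 1 + 1 by norm_num, Real.exp_add]
      rw [le_inv_comm₀ (by norm_num) (by positivity)]
      nlinarith [Real.exp_one_lt_d9, Real.exp_pos 1]
    calc (0.1 : ℝ) ^ T ≤ Real.exp (-2) ^ T := by gcongr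
      _ = Real.exp (-(2 * T)) := by rw [← Real.exp_nat_mul]; congr 1; ring
  set good := Q.filter fun π => s ≤ (X π : ℝ)
  have hbad : ∑ π ∈ Q.filter (fun π => ¬ s ≤ (X π : ℝ)), (X π : ℝ) ≤ 𝒞.card * a / 10 := by
    calc _ ≤ ((Q.filter fun π => ¬ s ≤ (X π : ℝ)).card : ℝ) * s := by
          rw [← nsmul_eq_mul]
          exact Finset.sum_le_card_nsmul _ _ _ fun π hπ => (not_le.1 (mem_filter.1 hπ).2).le
      _ ≤ Q.card * s := by gcongr; exact filter_subset _ _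
      _ ≤ Q.card * (𝒞.card * Real.exp (-(2 * T)) / 10) := by
          have : (𝒞.card : ℝ) * (0.1 : ℝ) ^ T ≤ 𝒞.card * Real.exp (-(2 * T)) := by gcongr
          gcongr
          linarith
      _ = 𝒞.card * (Real.exp (-(2 * T)) * Q.card) / 10 := by ring
      _ ≤ _ := by gcongr
  have hgood : 0.9 * (𝒞.card * a : ℝ) ≤ ∑ π ∈ good, (X π : ℝ) := by
    have h1 := Finset.sum_filter_add_sum_filter_not Q (fun π => s ≤ (X π : ℝ))
      (fun π => (X π : ℝ))
    have h2 : ∑ π ∈ Q, (X π : ℝ) = 𝒞.card * a := by exact_mod_cast hsum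
    rw [h2] at h1
    linarith
  have hCS : (∑ π ∈ good, (X π : ℝ)) ^ 2 ≤ good.card * ∑ π ∈ Q, (X π : ℝ) ^ 2 := by
    refine sq_sum_le_card_mul_sum_sq.trans ?_
    gcongr
    exact filter_subset _ _
  have hfin : 0.4 * T * (a : ℝ) ≤ good.card := by
    rcases Nat.eq_zero_or_pos a with h0 | h0
    · rw [h0]; simp
    · have hT' : (0 : ℝ) < T := by exact_mod_cast hT
      have ha' : (0 : ℝ) < a := by exact_mod_cast h0
      have hc' : (0 : ℝ) < 𝒞.card := by exact_mod_cast h𝒞0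
      have h1 : (0.9 * (𝒞.card * a : ℝ)) ^ 2 ≤ good.card * ∑ π ∈ Q, (X π : ℝ) ^ 2 :=
        (pow_le_pow_left₀ (by positivity) hgood 2).trans hCS
      have h2 : T * (0.9 * (𝒞.card * a : ℝ)) ^ 2 ≤ good.card * (2 * a * (𝒞.card : ℝ) ^ 2) := by
        calc _ ≤ T * (good.card * ∑ π ∈ Q, (X π : ℝ) ^ 2) := by gcongr
          _ = good.card * (T * ∑ π ∈ Q, (X π : ℝ) ^ 2) := by ring
          _ ≤ _ := by gcongr
      have h3 : 0 < (a : ℝ) * (𝒞.card : ℝ) ^ 2 := by positivity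
      refine le_of_mul_le_mul_right ?_ h3
      nlinarith [mul_pos (mul_pos hT' ha') h3]
  have hsubset : good ⊆ Q.filter fun π => s ≤ ((shatteredPart 𝒞 π).card : ℝ) := by
    refine Finset.monotone_filter_right _ fun π _ hπ => ?_
    refine le_trans hπ (Nat.cast_le.2 (card_le_card fun F hF => ?_))
    rw [mem_filter] at hF
    exact mem_filter.2 ⟨hF.1, hF.2.mono (hext F hF.1).1⟩
  calc _ = 0.4 * T * (Real.exp (-(2 * T)) * Q.card) := by ring
    _ ≤ 0.4 * T * a := by gcongr
    _ ≤ good.card := hfin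
    _ ≤ _ := Nat.cast_le.2 (card_le_card hsubset)

end Equipartition

/-! ### Anticoncentration of shattered polynomials -/

/-- The weight `|r| ^ (-1/4)`, with value `∞` at `0`. -/
noncomputable def invFourthRoot (r : ℝ) : ENNReal := ‖r‖ₑ ^ (-(1 / 4) : ℝ)

theorem measurable_invFourthRoot : Measurable invFourthRoot := by
  unfold invFourthRoot
  fun_prop

theorem invFourthRoot_zero : invFourthRoot 0 = ⊤ := by
  simp only [invFourthRoot, enorm_zero]
  exact ENNReal.zero_rpow_of_neg (by norm_num)

theorem invFourthRoot_mul {a b : ℝ} (ha : a ≠ 0) :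
    invFourthRoot (a * b) = invFourthRoot a * invFourthRoot b := by
  simp only [invFourthRoot, enorm_mul]
  by_cases hb : b = 0
  · subst hb
    simp only [enorm_zero, mul_zero]
    rw [ENNReal.zero_rpow_of_neg (by norm_num), ENNReal.mul_top]
    simp [ha]
  · exact ENNReal.mul_rpow_of_ne_zero (by simpa using ha) (by simpa using hb) _

theorem invFourthRoot_anti {a b : ℝ} (h : |a| ≤ |b|) : invFourthRoot b ≤ invFourthRoot a := by
  simp only [invFourthRoot]
  rw [ENNReal.rpow_neg, ENNReal.rpow_neg, ENNReal.inv_le_inv]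
  refine ENNReal.rpow_le_rpow ?_ (by norm_num)
  rw [Real.enorm_eq_ofReal_abs, Real.enorm_eq_ofReal_abs]
  exact ENNReal.ofReal_le_ofReal h

theorem invFourthRoot_of_pos {a : ℝ} (ha : 0 < a) :
    invFourthRoot a = ENNReal.ofReal (a ^ (-(1 / 4) : ℝ)) := by
  rw [invFourthRoot, Real.enorm_eq_ofReal_abs, abs_of_pos ha, ENNReal.ofReal_rpow_of_pos ha]

theorem invFourthRoot_inv_sixteen_pow (n : ℕ) : invFourthRoot ((16 : ℝ) ^ n)⁻¹ = 2 ^ n := by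
  rw [invFourthRoot_of_pos (by positivity)]
  have : ((16 : ℝ) ^ n)⁻¹ ^ (-(1 / 4) : ℝ) = 2 ^ n := by
    have h16 : (16 : ℝ) ^ n = ((2 : ℝ) ^ n) ^ (4 : ℝ) := by
      rw [show (4 : ℝ) = ((4 : ℕ) : ℝ) by norm_num, Real.rpow_natCast, ← pow_mul, mul_comm, pow_mul]
      norm_num
    rw [Real.rpow_neg (by positivity), Real.inv_rpow (by positivity), inv_inv, h16,
      ← Real.rpow_mul (by positivity)]
    norm_num
  rw [this, ENNReal.ofReal_pow (by norm_num)]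
  norm_num

/-- Dyadic layer-cake bound for the weight `|r| ^ (-1/4)`. -/
theorem invFourthRoot_le_tsum (r : ℝ) :
    invFourthRoot r ≤ 2 + ∑' k : ℕ, 2 ^ (k + 2) *
      Set.indicator {r : ℝ | |r| ≤ ((16 : ℝ) ^ (k + 1))⁻¹} (fun _ => (1 : ENNReal)) r := by
  rcases eq_or_ne r 0 with rfl | hr
  · have : (⊤ : ENNReal) ≤ ∑' k : ℕ, 2 ^ (k + 2) *
        Set.indicator {r : ℝ | |r| ≤ ((16 : ℝ) ^ (k + 1))⁻¹} (fun _ => (1 : ENNReal)) 0 := by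
      rw [← ENNReal.tsum_const_eq_top_of_ne_zero (α := ℕ) (one_ne_zero)]
      refine ENNReal.tsum_le_tsum fun k => ?_
      rw [Set.indicator_of_mem (by simp), mul_one]
      exact one_le_pow₀ (by norm_num)
    exact (le_top.trans this).trans le_add_self
  have hr' : 0 < |r| := abs_pos.2 hr
  have hbig : ∀ n : ℕ, ((16 : ℝ) ^ n)⁻¹ ≤ |r| → invFourthRoot r ≤ 2 ^ n := fun n hn => by
    rw [← invFourthRoot_inv_sixteen_pow]
    exact invFourthRoot_anti (by rwa [abs_of_pos (by positivity : (0 : ℝ) < ((16 : ℝ) ^ n)⁻¹)])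
  rcases le_or_gt (16⁻¹ : ℝ) |r| with h | h
  · refine le_trans ?_ le_self_add
    simpa using hbig 1 (by simpa using h)
  · obtain ⟨n, hn1, hn2⟩ := exists_nat_pow_near (x := |r|⁻¹) (y := (16 : ℝ))
      ((one_le_inv₀ hr').2 (by linarith)) (by norm_num)
    obtain ⟨k, rfl⟩ : ∃ k, n = k + 1 := by
      refine Nat.exists_eq_succ_of_ne_zero fun h0 => ?_
      subst h0
      rw [zero_add, pow_one, inv_lt_comm₀ hr' (by norm_num)] at hn2
      linarith
    rw [le_inv_comm₀ (by positivity) hr'] at hn1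
    rw [inv_lt_comm₀ hr' (by positivity)] at hn2
    refine le_trans ?_ le_add_self
    refine le_trans ?_ (ENNReal.le_tsum k)
    rw [Set.indicator_of_mem (by exact hn1), mul_one]
    exact hbig (k + 2) hn2.le

section LinearForm

variable {ι : Type*} [Fintype ι] {ν : ι → Measure ℝ}

/-- Negative moments of a linear form are bounded by those of its constant term. -/
theorem lintegral_invFourthRoot_add_linearForm_le (hν : ∀ i, IsNiceLaw (ν i)) (c : ι → ℝ) (a : ℝ) :
    ∫⁻ x, invFourthRoot (a + ∑ i, c i * x i) ∂(Measure.pi ν) ≤ 40002 * invFourthRoot a := by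
  have := fun i => (hν i).isProbabilityMeasure
  rcases eq_or_ne a 0 with rfl | ha
  · rw [invFourthRoot_zero, ENNReal.mul_top (by norm_num)]
    exact le_top
  set L : (ι → ℝ) → ℝ := fun x => ∑ i, -(c i / a) * x i - 1
  have hL : Measurable L := by fun_prop
  have hfac : ∀ x : ι → ℝ, a + ∑ i, c i * x i = (-a) * L x := fun x => by
    simp only [L]
    have : ∑ i, -a * (-(c i / a) * x i) = ∑ i, c i * x i :=
      Finset.sum_congr rfl fun i _ => by field_simp
    rw [mul_sub, Finset.mul_sum, this]
    ring
  have hneg : invFourthRoot (-a) = invFourthRoot a := by simp [invFourthRoot]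
  simp only [hfac]
  simp only [invFourthRoot_mul (neg_ne_zero.2 ha), hneg]
  rw [lintegral_const_mul (f := fun x => invFourthRoot (L x)) _
    (measurable_invFourthRoot.comp hL), mul_comm]
  gcongr
  have hmeas : ∀ k : ℕ, MeasurableSet {x : ι → ℝ | |L x| ≤ ((16 : ℝ) ^ (k + 1))⁻¹} := fun k =>
    measurableSet_le (by fun_prop) measurable_const
  have hprob : ∀ k : ℕ, (Measure.pi ν) {x | |L x| ≤ ((16 : ℝ) ^ (k + 1))⁻¹} ≤
      ENNReal.ofReal (20000 * ((4 : ℝ) ^ (k + 1))⁻¹) := fun k => by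
    rw [← ofReal_measureReal]
    refine ENNReal.ofReal_le_ofReal ?_
    refine (measureReal_abs_linearForm_sub_one_le hν _ (by positivity) ?_).trans ?_
    · rw [inv_lt_comm₀ (by positivity) (by norm_num)]
      have : (16 : ℝ) ^ 1 ≤ 16 ^ (k + 1) := pow_le_pow_right₀ (by norm_num) (by omega)
      norm_num at this ⊢
      linarith
    · have h1 : √(Real.logb 2 (1 / ((16 : ℝ) ^ (k + 1))⁻¹)) ≤ 4 ^ (k + 1) := by
        rw [one_div, inv_inv, Real.sqrt_le_left (by positivity), ← pow_mul, Real.logb_pow]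
        rw [show (16 : ℝ) = 2 ^ (4 : ℝ) by norm_num, Real.logb_rpow (by norm_num) (by norm_num)]
        have h2 : k + 1 < 4 ^ (k + 1) := Nat.lt_pow_self (by norm_num)
        have h3 : ((k + 1 : ℕ) : ℝ) < 4 ^ (k + 1) := by exact_mod_cast h2
        have h4 : (4 : ℝ) ≤ 4 ^ (k + 1) := by
          calc (4 : ℝ) = 4 ^ 1 := by norm_num
            _ ≤ _ := pow_le_pow_right₀ (by norm_num) (by omega)
        rw [pow_mul, sq]
        nlinarith
      have h16 : (16 : ℝ) ^ (k + 1) = 4 ^ (k + 1) * 4 ^ (k + 1) := by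
        rw [← mul_pow]; norm_num
      calc _ ≤ 20000 * ((16 : ℝ) ^ (k + 1))⁻¹ * 4 ^ (k + 1) := by gcongr
        _ = _ := by
          rw [h16]
          field_simp
  calc ∫⁻ x, invFourthRoot (L x) ∂(Measure.pi ν)
      ≤ ∫⁻ x, (2 + ∑' k : ℕ, 2 ^ (k + 2) *
          Set.indicator {x : ι → ℝ | |L x| ≤ ((16 : ℝ) ^ (k + 1))⁻¹} (fun _ => (1 : ENNReal)) x)
          ∂(Measure.pi ν) := lintegral_mono fun x => invFourthRoot_le_tsum (L x)
    _ = 2 + ∑' k : ℕ, 2 ^ (k + 2) * (Measure.pi ν) {x | |L x| ≤ ((16 : ℝ) ^ (k + 1))⁻¹} := by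
        rw [lintegral_add_left measurable_const, lintegral_tsum fun k =>
          ((measurable_const.indicator (hmeas k)).const_mul _).aemeasurable]
        simp only [lintegral_const, measure_univ, mul_one]
        congr 1
        refine tsum_congr fun k => ?_
        rw [lintegral_const_mul _ (measurable_const.indicator (hmeas k)),
          lintegral_indicator_const (hmeas k), one_mul]
    _ ≤ 2 + ∑' k : ℕ, 20000 * 2⁻¹ ^ k := by
        refine add_le_add le_rfl (ENNReal.tsum_le_tsum fun k => ?_)
        refine (mul_le_mul_right (hprob k) _).trans (le_of_eq ?_)
        have e1 : (2 : ENNReal) ^ (k + 2) = ENNReal.ofReal (2 ^ (k + 2)) := by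
          rw [ENNReal.ofReal_pow (by norm_num)]; norm_num
        have e2 : (20000 : ENNReal) * 2⁻¹ ^ k = ENNReal.ofReal (20000 * (2⁻¹) ^ k) := by
          rw [ENNReal.ofReal_mul (by norm_num), ENNReal.ofReal_pow (by norm_num),
            ENNReal.ofReal_inv_of_pos (by norm_num)]
          norm_num
        rw [e1, e2, ← ENNReal.ofReal_mul (by positivity)]
        congr 1
        rw [show (4 : ℝ) = 2 * 2 by norm_num, mul_pow, inv_pow]
        field_simp
        ring
    _ = 40002 := by
        rw [ENNReal.tsum_mul_left, ENNReal.tsum_geometric]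
        have : (1 - 2⁻¹ : ENNReal)⁻¹ = 2 := by
          rw [ENNReal.one_sub_inv_two, inv_inv]
        rw [this]
        norm_num

end LinearForm

section Shattered

variable {E : Type} {t : ℕ}

theorem measurable_coverPoly (𝒞 : Finset (Finset E)) :
    Measurable (coverPoly 𝒞 : (E → ℝ) → ℝ) := by
  unfold coverPoly
  fun_prop

variable [DecidableEq E]

/-- A polynomial all of whose monomials are shattered by `π` is affine in the variables of any one
part `j` of `π`; here these variables have been shifted by `m`, and `w` vanishes on the part. -/
theorem coverPoly_updateFinset {π : E → Fin t} {𝒞 : Finset (Finset E)}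
    (h𝒞 : ∀ F ∈ 𝒞, _root_.Shatters π F) (m : ℝ) {j : Fin t} {s : Finset E}
    (hs : ∀ e, e ∈ s ↔ π e = j) {w : E → ℝ} (hw : ∀ e, π e = j → w e = 0) (y : s → ℝ) :
    coverPoly 𝒞 (fun e => m + Function.updateFinset w s y e) =
      coverPoly 𝒞 (fun e => m + w e) + ∑ i : s,
        (∑ F ∈ 𝒞, if (i : E) ∈ F then ∏ e ∈ F.erase i, (m + w e) else 0) * y i := by
  have key : ∀ F ∈ 𝒞, ∏ e ∈ F, (m + Function.updateFinset w s y e) =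
      ∏ e ∈ F, (m + w e) + ∑ i : {e // e ∈ s},
        (if (i : E) ∈ F then ∏ e ∈ F.erase i, (m + w e) else 0) * y i := by
    intro F hF
    have hinj := shatters_iff_injOn.1 (h𝒞 F hF)
    by_cases hex : ∃ i ∈ F, i ∈ s
    · obtain ⟨i, hiF, his⟩ := hex
      have huniq : ∀ e ∈ F, e ∈ s → e = i := fun e he hes =>
        hinj he hiF (((hs e).1 hes).trans ((hs i).1 his).symm)
      have h1 : ∏ e ∈ F.erase i, (m + Function.updateFinset w s y e) =
          ∏ e ∈ F.erase i, (m + w e) := by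
        refine Finset.prod_congr rfl fun e he => ?_
        have : e ∉ s := fun hes =>
          Finset.ne_of_mem_erase he (huniq e (Finset.mem_of_mem_erase he) hes)
        simp [Function.updateFinset, this]
      have h2 : ∑ i' : {e // e ∈ s},
          (if (i' : E) ∈ F then ∏ e ∈ F.erase i', (m + w e) else 0) * y i' =
          (∏ e ∈ F.erase i, (m + w e)) * y ⟨i, his⟩ := by
        rw [Finset.sum_eq_single (⟨i, his⟩ : {e // e ∈ s})]
        · simp [hiF]
        · intro b _ hb
          have : (b : E) ∉ F := fun hbF => hb (Subtype.ext (huniq b hbF b.2))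
          simp [this]
        · intro h; exact absurd (mem_univ _) h
      rw [← Finset.mul_prod_erase _ _ hiF, ← Finset.mul_prod_erase _ (fun e => m + w e) hiF, h1, h2,
        hw i ((hs i).1 his)]
      simp only [Function.updateFinset, his, dif_pos]
      ring
    · push Not at hex
      have h2 : ∑ i' : {e // e ∈ s},
          (if (i' : E) ∈ F then ∏ e ∈ F.erase i', (m + w e) else 0) * y i' = 0 := by
        refine Finset.sum_eq_zero fun b _ => ?_
        have : (b : E) ∉ F := fun hbF => hex b hbF b.2
        simp [this]
      rw [h2, add_zero]
      refine Finset.prod_congr rfl fun e he => ?_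
      simp [Function.updateFinset, hex e he]
  simp only [coverPoly]
  rw [Finset.sum_congr rfl key, Finset.sum_add_distrib, Finset.sum_comm]
  congr 1
  refine Finset.sum_congr rfl fun i _ => ?_
  rw [Finset.sum_mul]

theorem lintegral_invFourthRoot_coverPoly_updateFinset_le {ν : E → Measure ℝ}
    (hν : ∀ e, IsNiceLaw (ν e)) {π : E → Fin t} {𝒞 : Finset (Finset E)}
    (h𝒞 : ∀ F ∈ 𝒞, _root_.Shatters π F) (m : ℝ) {j : Fin t} {s : Finset E}
    (hs : ∀ e, e ∈ s ↔ π e = j) {w : E → ℝ} (hw : ∀ e, π e = j → w e = 0) :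
    ∫⁻ y : s → ℝ, invFourthRoot (coverPoly 𝒞 fun e => m + Function.updateFinset w s y e)
        ∂(Measure.pi fun i : s => ν i) ≤
      40002 * invFourthRoot (coverPoly 𝒞 fun e => m + w e) := by
  simp only [coverPoly_updateFinset h𝒞 m hs hw]
  exact lintegral_invFourthRoot_add_linearForm_le (fun i : s => hν i) _ _

variable [Fintype E]

/-- Integrating out the variables of the parts in `J` one part at a time costs a constant factor
per part: each step is the linear case, since the polynomial is affine in the variables of a
part. -/
theorem lmarginal_invFourthRoot_coverPoly_le {ν : E → Measure ℝ} (hν : ∀ e, IsNiceLaw (ν e))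
    {π : E → Fin t} {𝒞 : Finset (Finset E)} (h𝒞 : ∀ F ∈ 𝒞, _root_.Shatters π F) (m : ℝ)
    (J : Finset (Fin t)) (x : E → ℝ) :
    (lmarginal ν (univ.filter fun e => π e ∈ J)
        (fun x => invFourthRoot (coverPoly 𝒞 fun e => m + x e))) x ≤
      40002 ^ J.card *
        invFourthRoot (coverPoly 𝒞 fun e => m + if π e ∈ J then 0 else x e) := by
  have := fun i => (hν i).isProbabilityMeasure
  have hmeas : Measurable fun x : E → ℝ => invFourthRoot (coverPoly 𝒞 fun e => m + x e) :=
    measurable_invFourthRoot.comp ((measurable_coverPoly 𝒞).comp (by fun_prop))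
  induction J using Finset.induction_on generalizing x with
  | empty => simp
  | insert j J hj ih =>
    have hunion : (univ.filter fun e => π e ∈ insert j J) =
        (univ.filter fun e => π e = j) ∪ univ.filter fun e => π e ∈ J := by
      ext e; simp
    have hdisj : Disjoint (univ.filter fun e => π e = j) (univ.filter fun e => π e ∈ J) := by
      rw [Finset.disjoint_filter]
      rintro e - rfl
      exact hj
    rw [hunion, lmarginal_union ν _ hmeas hdisj]
    refine (lmarginal_mono (μ := ν) (f := _) (s := univ.filter fun e => π e = j) ih x).trans ?_
    set w : E → ℝ := fun e => if π e ∈ insert j J then 0 else x e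
    have hw : ∀ e, π e = j → w e = 0 := fun e he => by simp [w, he]
    have hupd : ∀ (y : {e // e ∈ univ.filter fun e => π e = j} → ℝ) (e : E),
        (if π e ∈ J then 0 else
          Function.updateFinset x (univ.filter fun e => π e = j) y e) =
        Function.updateFinset w (univ.filter fun e => π e = j) y e := fun y e => by
      by_cases h1 : π e = j
      · have : π e ∉ J := h1 ▸ hj
        simp only [Function.updateFinset, mem_filter, mem_univ, true_and, h1, dif_pos]
        rw [if_neg hj]
      · by_cases h2 : π e ∈ J <;> simp [Function.updateFinset, w, h1, h2]
    simp only [lmarginal, hupd]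
    rw [lintegral_const_mul' _ _ (by finiteness)]
    rw [card_insert_of_notMem hj, pow_succ, mul_assoc]
    exact mul_le_mul_right (lintegral_invFourthRoot_coverPoly_updateFinset_le hν h𝒞 m
      (fun e => by simp) hw) _

/-- Anticoncentration of a shattered polynomial, relative to its mean `coverPoly 𝒞 m`. -/
theorem measure_abs_coverPoly_lt_le {ν : E → Measure ℝ} (hν : ∀ e, IsNiceLaw (ν e))
    {π : E → Fin t} {𝒞 : Finset (Finset E)} (h𝒞 : ∀ F ∈ 𝒞, _root_.Shatters π F) {m v θ : ℝ}
    (hv : 0 < v) (hθ : 0 < θ) (hm : v ≤ coverPoly 𝒞 fun _ => m) :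
    (Measure.pi ν) {x | |coverPoly 𝒞 fun e => m + x e| < θ} ≤
      ENNReal.ofReal (40002 ^ t * (θ / v) ^ (1 / 4 : ℝ)) := by
  have := fun i => (hν i).isProbabilityMeasure
  have hmeas : Measurable fun x : E → ℝ => invFourthRoot (coverPoly 𝒞 fun e => m + x e) :=
    measurable_invFourthRoot.comp ((measurable_coverPoly 𝒞).comp (by fun_prop))
  have h1 : ∫⁻ x, invFourthRoot (coverPoly 𝒞 fun e => m + x e) ∂(Measure.pi ν) ≤
      40002 ^ t * invFourthRoot v := by
    have h2 := lmarginal_invFourthRoot_coverPoly_le hν h𝒞 m univ (fun _ => 0)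
    simp only [mem_univ, filter_true, lmarginal_univ, if_true, add_zero, card_univ,
      Fintype.card_fin] at h2
    refine h2.trans ?_
    gcongr
    refine invFourthRoot_anti ?_
    rw [abs_of_pos hv, abs_of_pos (hv.trans_le hm)]
    exact hm
  have hθ' := invFourthRoot_of_pos hθ
  have hpos : 0 < θ ^ (-(1 / 4) : ℝ) := Real.rpow_pos_of_pos hθ _
  calc (Measure.pi ν) {x | |coverPoly 𝒞 fun e => m + x e| < θ}
      ≤ (Measure.pi ν) {x | invFourthRoot θ ≤ invFourthRoot (coverPoly 𝒞 fun e => m + x e)} := by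
        refine measure_mono fun x hx => ?_
        have hx' : |coverPoly 𝒞 fun e => m + x e| < θ := hx
        exact invFourthRoot_anti (by rw [abs_of_pos hθ]; exact hx'.le)
    _ ≤ (∫⁻ x, invFourthRoot (coverPoly 𝒞 fun e => m + x e) ∂(Measure.pi ν)) / invFourthRoot θ := by
        refine meas_ge_le_lintegral_div hmeas.aemeasurable ?_ ?_
        · rw [hθ']; simpa using hpos
        · rw [hθ']; exact ENNReal.ofReal_ne_top
    _ ≤ 40002 ^ t * invFourthRoot v / invFourthRoot θ := by gcongr
    _ = _ := by
        rw [hθ', invFourthRoot_of_pos hv, mul_div_assoc, ← ENNReal.ofReal_div_of_pos hpos,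
          ENNReal.ofReal_mul (by positivity), ENNReal.ofReal_pow (by norm_num)]
        congr 2
        · norm_num
        · rw [Real.rpow_neg hv.le, Real.rpow_neg hθ.le, Real.div_rpow hθ.le hv.le]
          field_simp

/-- Distinct multilinear monomials in independent centered variables are uncorrelated. -/
theorem measureReal_le_abs_coverPoly_le {ν : E → Measure ℝ} [∀ e, IsProbabilityMeasure (ν e)]
    (hν : ∀ e, ∀ᵐ x ∂(ν e), |x| ≤ 1) (hmean : ∀ e, ∫ x, x ∂(ν e) = 0) (𝒞 : Finset (Finset E))
    {θ : ℝ} (hθ : 0 < θ) :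
    (Measure.pi ν).real {x | θ ≤ |coverPoly 𝒞 x|} ≤ 𝒞.card / θ ^ 2 := by
  have hae : ∀ᵐ x ∂(Measure.pi ν), ∀ e, |x e| ≤ 1 := ae_all_iff.2 fun e =>
    (measurePreserving_eval ν e).quasiMeasurePreserving.ae (hν e)
  have hint : ∀ F F' : Finset E,
      Integrable (fun x : E → ℝ => (∏ e ∈ F, x e) * ∏ e ∈ F', x e) (Measure.pi ν) := fun F F' => by
    refine Integrable.of_bound (by fun_prop) 1 ?_
    filter_upwards [hae] with x hx
    have h1 : ∀ F : Finset E, |∏ e ∈ F, x e| ≤ 1 := fun F => by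
      rw [Finset.abs_prod]
      exact Finset.prod_le_one (fun _ _ => abs_nonneg _) fun e _ => hx e
    rw [Real.norm_eq_abs, abs_mul]
    exact mul_le_one₀ (h1 F) (abs_nonneg _) (h1 F')
  have hexp : ∀ x : E → ℝ, coverPoly 𝒞 x ^ 2 =
      ∑ F ∈ 𝒞, ∑ F' ∈ 𝒞, (∏ e ∈ F, x e) * ∏ e ∈ F', x e := fun x => by
    rw [sq, coverPoly, Finset.sum_mul_sum]
  have hterm : ∀ F F' : Finset E,
      ∫ x : E → ℝ, (∏ e ∈ F, x e) * ∏ e ∈ F', x e ∂(Measure.pi ν) ≤ if F = F' then 1 else 0 := by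
    intro F F'
    split_ifs with h
    · calc _ ≤ ∫ x : E → ℝ, (1 : ℝ) ∂(Measure.pi ν) := by
            refine integral_mono_ae (hint F F') (integrable_const _) ?_
            filter_upwards [hae] with x hx
            have h1 : ∀ F : Finset E, |∏ e ∈ F, x e| ≤ 1 := fun F => by
              rw [Finset.abs_prod]
              exact Finset.prod_le_one (fun _ _ => abs_nonneg _) fun e _ => hx e
            refine (le_abs_self _).trans ?_
            rw [abs_mul]
            exact mul_le_one₀ (h1 F) (abs_nonneg _) (h1 F')
        _ = 1 := by simp
    · have e1 : ∀ x : E → ℝ, (∏ e ∈ F, x e) * ∏ e ∈ F', x e =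
          ∏ e, (if e ∈ F then x e else 1) * (if e ∈ F' then x e else 1) := fun x => by
        rw [Finset.prod_mul_distrib]
        simp
      simp only [e1]
      rw [integral_fintype_prod_eq_prod (𝕜 := ℝ) (μ := ν)
        (fun e y => (if e ∈ F then y else 1) * (if e ∈ F' then y else 1))]
      obtain ⟨e, he⟩ : ∃ e, ¬ (e ∈ F ↔ e ∈ F') := by
        by_contra! hh
        exact h (Finset.ext hh)
      refine (Finset.prod_eq_zero (mem_univ e) ?_).le
      by_cases h1 : e ∈ F <;> by_cases h2 : e ∈ F'
      · exact absurd (iff_of_true h1 h2) he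
      · simp [h1, h2, hmean]
      · simp [h1, h2, hmean]
      · exact absurd (iff_of_false h1 h2) he
  have hintsq : Integrable (fun x => coverPoly 𝒞 x ^ 2) (Measure.pi ν) := by
    simp only [hexp]
    exact integrable_finsetSum _ fun F _ => integrable_finsetSum _ fun F' _ => hint F F'
  have hsecond : ∫ x, coverPoly 𝒞 x ^ 2 ∂(Measure.pi ν) ≤ 𝒞.card := by
    simp only [hexp]
    rw [integral_finsetSum _ fun F _ => integrable_finsetSum _ fun F' _ => hint F F']
    calc _ ≤ ∑ F ∈ 𝒞, (1 : ℝ) := by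
          refine Finset.sum_le_sum fun F hF => ?_
          rw [integral_finsetSum _ fun F' _ => hint F F']
          refine (Finset.sum_le_sum fun F' _ => hterm F F').trans ?_
          simp [hF]
      _ = _ := by simp
  have hmarkov := mul_meas_ge_le_integral_of_nonneg (μ := Measure.pi ν)
    (ae_of_all _ fun x => sq_nonneg (coverPoly 𝒞 x)) hintsq (θ ^ 2)
  have hset : {x : E → ℝ | θ ≤ |coverPoly 𝒞 x|} = {x | θ ^ 2 ≤ coverPoly 𝒞 x ^ 2} := by
    ext x
    simp only [Set.mem_ofPred_eq]
    rw [← sq_abs (coverPoly 𝒞 x)]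
    exact (pow_le_pow_iff_left₀ hθ.le (abs_nonneg _) two_ne_zero).symm
  rw [hset, le_div_iff₀ (by positivity), mul_comm]
  exact hmarkov.trans hsecond

end Shattered

/-! ### The law of the masked signs -/

theorem measurable_unitsInt_cast : Measurable fun η : ℤˣ => ((η : ℤ) : ℝ) :=
  measurable_from_top.comp (comap_measurable Units.val)

instance Int.instMeasurableSingletonClassUnits : MeasurableSingletonClass ℤˣ where
  measurableSet_singleton η :=
    ⟨{(η : ℤ)}, measurableSet_singleton _, by ext; simp [Units.ext_iff]⟩

theorem isProbabilityMeasure_signLaw {ρ : ℝ} (h0 : 0 ≤ ρ) (h1 : ρ ≤ 1) :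
    IsProbabilityMeasure (signLaw ρ) := by
  refine ⟨?_⟩
  simp only [signLaw, Measure.coe_add, Measure.coe_smul, Pi.add_apply, Pi.smul_apply, measure_univ,
    smul_eq_mul, mul_one]
  rw [← ENNReal.ofReal_add (by linarith) (by linarith), ENNReal.ofReal_eq_one]
  ring

theorem integral_signLaw {ρ : ℝ} (h0 : 0 ≤ ρ) (h1 : ρ ≤ 1) :
    ∫ η, ((η : ℤ) : ℝ) ∂(signLaw ρ) = ρ := by
  have hm : StronglyMeasurable fun η : ℤˣ => ((η : ℤ) : ℝ) :=
    measurable_unitsInt_cast.stronglyMeasurable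
  have hi : ∀ x : ℤˣ, Integrable (fun η : ℤˣ => ((η : ℤ) : ℝ)) (Measure.dirac x) := fun x =>
    integrable_dirac' hm (by simp)
  rw [signLaw, integral_add_measure ((hi 1).smul_measure ENNReal.ofReal_ne_top)
    ((hi (-1)).smul_measure ENNReal.ofReal_ne_top), integral_smul_measure, integral_smul_measure,
    integral_dirac' _ _ hm, integral_dirac' _ _ hm, ENNReal.toReal_ofReal (by linarith),
    ENNReal.toReal_ofReal (by linarith)]
  simp
  ring

theorem isProbabilityMeasure_restrict_Icc :
    IsProbabilityMeasure (volume.restrict (Set.Icc (0 : ℝ) 1)) := ⟨by simp⟩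

/-- The law of `ξ η - ρ / 2`, where `ξ` is uniform on `[0, 1]` and `η` is an independent sign of
mean `ρ`. -/
noncomputable def noiseLaw (ρ : ℝ) : Measure ℝ :=
  ((signLaw ρ).prod (volume.restrict (Set.Icc (0 : ℝ) 1))).map
    fun p => p.2 * ((p.1 : ℤ) : ℝ) - ρ / 2

theorem measurable_maskedSign (ρ : ℝ) :
    Measurable fun p : ℤˣ × ℝ => p.2 * ((p.1 : ℤ) : ℝ) - ρ / 2 :=
  (measurable_snd.mul (measurable_unitsInt_cast.comp measurable_fst)).sub_const _

/-- Bounded masking spreads the two atoms of a sign over two unit intervals, with weights that add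
up to `1`. -/
theorem noiseLaw_le_volume {ρ : ℝ} (h0 : 0 ≤ ρ) (h1 : ρ ≤ 1) : noiseLaw ρ ≤ volume := by
  refine Measure.le_iff.2 fun A hA => ?_
  have hpre := measurable_maskedSign ρ hA
  rw [noiseLaw, Measure.map_apply (measurable_maskedSign ρ) hA, Measure.prod_apply hpre, signLaw,
    lintegral_add_measure, lintegral_smul_measure, lintegral_smul_measure,
    lintegral_dirac' _ (measurable_measure_prodMk_left hpre),
    lintegral_dirac' _ (measurable_measure_prodMk_left hpre)]
  have e1 : (volume.restrict (Set.Icc (0 : ℝ) 1)) (Prod.mk (1 : ℤˣ) ⁻¹'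
      ((fun p : ℤˣ × ℝ => p.2 * ((p.1 : ℤ) : ℝ) - ρ / 2) ⁻¹' A)) ≤ volume A := by
    refine (Measure.restrict_apply_le _ _).trans (le_of_eq ?_)
    have : (Prod.mk (1 : ℤˣ) ⁻¹' ((fun p : ℤˣ × ℝ => p.2 * ((p.1 : ℤ) : ℝ) - ρ / 2) ⁻¹' A)) =
        (fun x : ℝ => x - ρ / 2) ⁻¹' A := by
      ext x; simp
    rw [this]
    exact (measurePreserving_sub_right volume (ρ / 2)).measure_preimage hA.nullMeasurableSet
  have e2 : (volume.restrict (Set.Icc (0 : ℝ) 1)) (Prod.mk (-1 : ℤˣ) ⁻¹'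
      ((fun p : ℤˣ × ℝ => p.2 * ((p.1 : ℤ) : ℝ) - ρ / 2) ⁻¹' A)) ≤ volume A := by
    refine (Measure.restrict_apply_le _ _).trans (le_of_eq ?_)
    have : (Prod.mk (-1 : ℤˣ) ⁻¹' ((fun p : ℤˣ × ℝ => p.2 * ((p.1 : ℤ) : ℝ) - ρ / 2) ⁻¹' A)) =
        (fun x : ℝ => -x) ⁻¹' ((fun x : ℝ => x - ρ / 2) ⁻¹' A) := by
      ext x; simp
    rw [this, (Measure.measurePreserving_neg volume).measure_preimage
      (hA.preimage (by fun_prop)).nullMeasurableSet]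
    exact (measurePreserving_sub_right volume (ρ / 2)).measure_preimage hA.nullMeasurableSet
  calc _ ≤ ENNReal.ofReal ((1 + ρ) / 2) * volume A + ENNReal.ofReal ((1 - ρ) / 2) * volume A := by
        simp only [smul_eq_mul]
        gcongr
    _ = volume A := by
        rw [← add_mul, ← ENNReal.ofReal_add (by linarith) (by linarith)]
        have : (1 + ρ) / 2 + (1 - ρ) / 2 = 1 := by ring
        rw [this, ENNReal.ofReal_one, one_mul]

theorem isProbabilityMeasure_noiseLaw {ρ : ℝ} (h0 : 0 ≤ ρ) (h1 : ρ ≤ 1) :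
    IsProbabilityMeasure (noiseLaw ρ) := by
  have := isProbabilityMeasure_signLaw h0 h1
  have := isProbabilityMeasure_restrict_Icc
  exact Measure.isProbabilityMeasure_map (measurable_maskedSign ρ).aemeasurable

theorem ae_noiseLaw_abs_le {ρ : ℝ} (h0 : 0 ≤ ρ) (h1 : ρ ≤ 1) :
    ∀ᵐ x ∂(noiseLaw ρ), |x| ≤ 1 + ρ / 2 := by
  have := isProbabilityMeasure_signLaw h0 h1
  have := isProbabilityMeasure_restrict_Icc
  rw [noiseLaw, ae_map_iff (measurable_maskedSign ρ).aemeasurable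
    (measurableSet_le (by fun_prop) measurable_const)]
  have h2 : ∀ᵐ p ∂((signLaw ρ).prod (volume.restrict (Set.Icc (0 : ℝ) 1))),
      p.2 ∈ Set.Icc (0 : ℝ) 1 :=
    Measure.quasiMeasurePreserving_snd.ae (ae_restrict_mem measurableSet_Icc)
  filter_upwards [h2] with p hp
  have h3 : |p.2 * ((p.1 : ℤ) : ℝ)| ≤ 1 := by
    rcases Int.units_eq_one_or p.1 with h | h <;> rw [h] <;> simp <;>
      exact abs_le.2 ⟨by linarith [hp.1], hp.2⟩
  calc _ ≤ |p.2 * ((p.1 : ℤ) : ℝ)| + |ρ / 2| := abs_sub _ _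
    _ ≤ _ := by rw [abs_of_nonneg (by linarith : 0 ≤ ρ / 2)]; linarith

theorem integral_noiseLaw {ρ : ℝ} (h0 : 0 ≤ ρ) (h1 : ρ ≤ 1) : ∫ x, x ∂(noiseLaw ρ) = 0 := by
  have := isProbabilityMeasure_signLaw h0 h1
  have := isProbabilityMeasure_restrict_Icc
  rw [noiseLaw, integral_map (measurable_maskedSign ρ).aemeasurable (by fun_prop)]
  have hs : Integrable (fun η : ℤˣ => ((η : ℤ) : ℝ)) (signLaw ρ) := by
    refine Integrable.of_bound measurable_unitsInt_cast.aestronglyMeasurable 1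
      (ae_of_all _ fun η => ?_)
    rcases Int.units_eq_one_or η with h | h <;> rw [h] <;> simp
  have hx : Integrable (fun x : ℝ => x) (volume.restrict (Set.Icc (0 : ℝ) 1)) :=
    Integrable.of_mem_Icc 0 1 aemeasurable_id (ae_restrict_mem measurableSet_Icc)
  have hprod : Integrable (fun p : ℤˣ × ℝ => p.2 * ((p.1 : ℤ) : ℝ))
      ((signLaw ρ).prod (volume.restrict (Set.Icc (0 : ℝ) 1))) := by
    simpa only [mul_comm] using hs.mul_prod hx
  rw [integral_sub hprod (integrable_const _)]
  have e1 : ∫ p : ℤˣ × ℝ, p.2 * ((p.1 : ℤ) : ℝ)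
      ∂((signLaw ρ).prod (volume.restrict (Set.Icc (0 : ℝ) 1))) = ρ * (1 / 2) := by
    simp only [mul_comm (_ : ℝ) ((_ : ℤ) : ℝ)]
    rw [integral_prod_mul (fun η : ℤˣ => ((η : ℤ) : ℝ)) (fun x : ℝ => x), integral_signLaw h0 h1,
      integral_Icc_eq_integral_Ioc, ← intervalIntegral.integral_of_le (by norm_num), integral_id]
    norm_num
  rw [e1]
  simp
  ring

theorem isNiceLaw_noiseLaw {ρ : ℝ} (h0 : 0 ≤ ρ) (h1 : ρ ≤ 1) : IsNiceLaw (noiseLaw ρ) := by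
  have := isProbabilityMeasure_noiseLaw h0 h1
  have hle := noiseLaw_le_volume h0 h1
  refine ⟨this, ?_, integral_noiseLaw h0 h1, fun x => min ((noiseLaw ρ).rnDeriv volume x) 1,
    (Measure.measurable_rnDeriv _ _).min measurable_const, fun x => min_le_right _ _, ?_⟩
  · have h2 : ∀ᵐ x ∂(noiseLaw ρ), x ∈ Set.Icc (-2 : ℝ) 2 := by
      filter_upwards [ae_noiseLaw_abs_le h0 h1] with x hx
      exact abs_le.1 (hx.trans (by linarith))
    exact h2
  · conv_lhs =>
      rw [← Measure.withDensity_rnDeriv_eq _ _ (Measure.absolutelyContinuous_of_le hle)]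
    refine withDensity_congr_ae ?_
    filter_upwards [Measure.rnDeriv_le_one_of_le hle] with x hx
    exact (min_eq_left hx).symm

theorem measurePreserving_maskedSigns {E : Type} [Fintype E] {ρ : ℝ} (h0 : 0 ≤ ρ) (h1 : ρ ≤ 1) :
    MeasurePreserving (fun (p : (E → ℤˣ) × (E → ℝ)) e => p.2 e * ((p.1 e : ℤ) : ℝ) - ρ / 2)
      ((Measure.pi fun _ : E => signLaw ρ).prod
        (Measure.pi fun _ : E => volume.restrict (Set.Icc (0 : ℝ) 1)))
      (Measure.pi fun _ : E => noiseLaw ρ) := by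
  have := isProbabilityMeasure_signLaw h0 h1
  have := isProbabilityMeasure_restrict_Icc
  have := isProbabilityMeasure_noiseLaw h0 h1
  have hA := (measurePreserving_arrowProdEquivProdArrow ℤˣ ℝ E (fun _ => signLaw ρ)
    fun _ => volume.restrict (Set.Icc (0 : ℝ) 1)).symm
  have hB : MeasurePreserving
      (fun (q : E → ℤˣ × ℝ) e => (q e).2 * (((q e).1 : ℤ) : ℝ) - ρ / 2)
      (Measure.pi fun _ : E => (signLaw ρ).prod (volume.restrict (Set.Icc (0 : ℝ) 1)))
      (Measure.pi fun _ : E => noiseLaw ρ) :=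
    measurePreserving_pi _ _ fun _ => ⟨measurable_maskedSign ρ, rfl⟩
  exact hB.comp hA

/-! ### Even covers -/

namespace UniformHypergraph

variable {n k : ℕ} {G : UniformHypergraph n k}

/-- The planted assignment cancels in the product of the right-hand sides over an even cover. -/
theorem IsEvenCover.prod_prod_eq_one {F : Finset G.Edge} (hF : G.IsEvenCover F) (z : Fin n → ℤˣ) :
    ∏ e ∈ F, ∏ v ∈ e.1, z v = 1 := by
  have h1 : ∀ e : G.Edge, ∏ v ∈ e.1, z v = ∏ v, if v ∈ e.1 then z v else 1 := fun e => by simp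
  simp only [h1]
  rw [Finset.prod_comm]
  refine Finset.prod_eq_one fun v _ => ?_
  rw [Finset.prod_ite, Finset.prod_const_one, mul_one, Finset.prod_const]
  obtain ⟨r, hr⟩ := hF v
  rw [hr, pow_add, ← mul_pow, Int.units_mul_self, one_pow]

theorem coverPoly_mul_eq {𝒞 : Finset (Finset G.Edge)} (h𝒞 : ∀ F ∈ 𝒞, G.IsEvenCover F)
    (z : Fin n → ℤˣ) (η : G.Edge → ℤˣ) (ξ : G.Edge → ℝ) :
    coverPoly 𝒞 (fun e => ξ e * (((η e * ∏ v ∈ e.1, z v : ℤˣ) : ℤ) : ℝ)) =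
      coverPoly 𝒞 fun e => ξ e * ((η e : ℤ) : ℝ) := by
  unfold coverPoly
  refine Finset.sum_congr rfl fun F hF => ?_
  have h1 := congrArg (fun u : ℤˣ => ((u : ℤ) : ℝ)) ((h𝒞 F hF).prod_prod_eq_one z)
  simp only [Units.coe_prod, Int.cast_prod, Units.val_one, Int.cast_one] at h1
  simp only [Units.val_mul, Int.cast_mul, Units.coe_prod, Int.cast_prod, ← mul_assoc]
  rw [Finset.prod_mul_distrib, h1, mul_one]

theorem measurable_plant (z : Fin n → ℤˣ) :
    Measurable fun (η : G.Edge → ℤˣ) (e : G.Edge) => η e * ∏ v ∈ e.1, z v :=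
  Measurable.of_discrete

end UniformHypergraph

/-! ### Analysis of the algorithm -/

section Algorithm

variable {E : Type}

/-- The family of covers on which the algorithm evaluates its polynomial once the partition `π` has
been accepted. -/
noncomputable def restrictedPart (N T : ℕ) (ε : ℝ)
    (pick : (E → Fin (2 * T)) → Finset (Finset E) → Finset (Finset E))
    (𝒞 : Finset (Finset E)) (π : E → Fin (2 * T)) : Finset (Finset E) :=
  if targetSize N T ε < ((shatteredPart 𝒞 π).card : ℝ) then pick π (shatteredPart 𝒞 π)
  else shatteredPart 𝒞 π

theorem restrictedPart_spec {N T : ℕ} {ε : ℝ}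
    {pick : (E → Fin (2 * T)) → Finset (Finset E) → Finset (Finset E)}
    (hpick : IsRestrictionRule (targetSize N T ε) pick) {𝒞 : Finset (Finset E)}
    {π : E → Fin (2 * T)} (hπ : targetSize N T ε ≤ ((shatteredPart 𝒞 π).card : ℝ)) :
    restrictedPart N T ε pick 𝒞 π ⊆ shatteredPart 𝒞 π ∧
      targetSize N T ε ≤ ((restrictedPart N T ε pick 𝒞 π).card : ℝ) ∧
      ((restrictedPart N T ε pick 𝒞 π).card : ℝ) ≤ targetSize N T ε + 1 := by
  have h0 : 0 ≤ targetSize N T ε := by unfold targetSize; positivity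
  unfold restrictedPart
  split_ifs with h
  · obtain ⟨h1, h2⟩ := hpick π _ h
    rw [h2]
    exact ⟨h1, Nat.le_ceil _, (Nat.ceil_lt_add_one h0).le⟩
  · exact ⟨Subset.rfl, hπ, by linarith⟩

theorem distinguish_cases (N T : ℕ) (ε : ℝ)
    (pick : (E → Fin (2 * T)) → Finset (Finset E) → Finset (Finset E))
    (𝒞 : Finset (Finset E)) (b : E → ℤˣ)
    (πs : Fin (numIterations T) → E → Fin (2 * T)) (ξ : E → ℝ) :
    (∀ i, ¬ targetSize N T ε ≤ ((shatteredPart 𝒞 (πs i)).card : ℝ)) ∨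
      ∃ i, (List.ofFn πs).find? (fun π =>
          decide (targetSize N T ε ≤ ((shatteredPart 𝒞 π).card : ℝ))) = some (πs i) ∧
        distinguish N T ε pick 𝒞 b πs ξ =
          if (N : ℝ) ^ (0.6 * ε) ≤ |coverPoly (restrictedPart N T ε pick 𝒞 (πs i))
            (fun e => ξ e * ((b e : ℤ) : ℝ))| then Guess.planted else Guess.null := by
  unfold distinguish
  rcases hfind : (List.ofFn πs).find? (fun π =>
    decide (targetSize N T ε ≤ ((shatteredPart 𝒞 π).card : ℝ))) with _ | π
  · left
    intro i
    have := List.find?_eq_none.1 hfind (πs i) (List.mem_ofFn.2 ⟨i, rfl⟩)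
    simpa using this
  · right
    obtain ⟨i, rfl⟩ := List.mem_ofFn.1 (List.mem_of_find?_eq_some hfind)
    exact ⟨i, rfl, rfl⟩

/-- The partition accepted by the loop is independent of the signs and of the multipliers, so a
bound `q` on the error that holds for each accepted partition holds on average. -/
theorem measure_prod_accepted_le {B X P : Type*} [MeasurableSpace B] [MeasurableSpace X]
    [MeasurableSpace P] [Fintype P] [MeasurableSingletonClass P] (μ : Measure B) (κ : Measure P)
    (ξ : Measure X) [SFinite μ] [IsProbabilityMeasure κ] [SFinite ξ] {bad : P → Set (B × X)}
    (hbad : ∀ p, MeasurableSet (bad p)) {q : ENNReal} (hq : ∀ p, (μ.prod ξ) (bad p) ≤ q) :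
    (μ.prod (κ.prod ξ)) {ω | (ω.1, ω.2.2) ∈ bad ω.2.1} ≤ q := by
  have hsplit : {ω : B × P × X | (ω.1, ω.2.2) ∈ bad ω.2.1} =
      ⋃ p, {ω : B × P × X | ω.2.1 = p ∧ (ω.1, ω.2.2) ∈ bad p} := by
    ext ω
    simp
  have hmeas : ∀ p, MeasurableSet {ω : B × P × X | ω.2.1 = p ∧ (ω.1, ω.2.2) ∈ bad p} := fun p =>
    ((measurable_fst.comp measurable_snd) (measurableSet_singleton p)).inter
      ((measurable_fst.prodMk (measurable_snd.comp measurable_snd)) (hbad p))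
  have hp : ∀ p, (μ.prod (κ.prod ξ)) {ω : B × P × X | ω.2.1 = p ∧ (ω.1, ω.2.2) ∈ bad p} =
      κ {p} * (μ.prod ξ) (bad p) := fun p => by
    rw [Measure.prod_apply (hmeas p), Measure.prod_apply (hbad p), ← lintegral_const_mul _
      (measurable_measure_prodMk_left (hbad p))]
    refine lintegral_congr fun b => ?_
    rw [← Measure.prod_prod]
    rfl
  rw [hsplit]
  calc _ ≤ ∑ p, (μ.prod (κ.prod ξ)) {ω : B × P × X | ω.2.1 = p ∧ (ω.1, ω.2.2) ∈ bad p} :=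
        measure_iUnion_fintype_le _ _
    _ ≤ ∑ p, κ {p} * q := by
        refine Finset.sum_le_sum fun p _ => ?_
        rw [hp]
        gcongr
        exact hq p
    _ = q := by
        rw [← Finset.sum_mul, sum_measure_singleton]
        simp

theorem measurable_maskedCoverPoly (𝒟 : Finset (Finset E)) :
    Measurable fun p : (E → ℤˣ) × (E → ℝ) =>
      coverPoly 𝒟 fun e => p.2 e * ((p.1 e : ℤ) : ℝ) := by
  refine (measurable_coverPoly 𝒟).comp (measurable_pi_iff.2 fun e => ?_)
  exact ((measurable_pi_apply e).comp measurable_snd).mul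
    (measurable_unitsInt_cast.comp ((measurable_pi_apply e).comp measurable_fst))

variable [Fintype E] [DecidableEq E]

theorem isProbabilityMeasure_uniformOn_isEquipartition {t : ℕ} (ht : 0 < t) :
    IsProbabilityMeasure (uniformOn {π : E → Fin t | IsEquipartition π}) :=
  isProbabilityMeasure_uniformOn (Set.toFinite _) (exists_isEquipartition E ht)

/-- The loop accepts a partition except with probability `exp (-4 T)`. -/
theorem measure_forall_not_accepted_le {T : ℕ} (hT : 0 < T) {𝒞 : Finset (Finset E)}
    (h𝒞 : ∀ F ∈ 𝒞, F.card ≤ 2 * T) (hlarge : 2 ^ (10 * T) ≤ 𝒞.card) {s : ℝ} (hs0 : 0 ≤ s)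
    (hs : 10 * s ≤ 𝒞.card * (0.1 : ℝ) ^ T) :
    (Measure.pi fun _ : Fin (numIterations T) =>
        uniformOn {π : E → Fin (2 * T) | IsEquipartition π})
      {πs | ∀ i, ¬ s ≤ ((shatteredPart 𝒞 (πs i)).card : ℝ)} ≤
      ENNReal.ofReal (Real.exp (-4 * T)) := by
  have hprob := isProbabilityMeasure_uniformOn_isEquipartition (E := E) (t := 2 * T) (by omega)
  set κ := uniformOn {π : E → Fin (2 * T) | IsEquipartition π} with hκ
  set good : Finset (E → Fin (2 * T)) := univ.filter fun π => s ≤ ((shatteredPart 𝒞 π).card : ℝ)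
  set p := 0.4 * T * Real.exp (-(2 * T))
  have hgood : ENNReal.ofReal p ≤ κ good := by
    have h1 : {π : E → Fin (2 * T) | IsEquipartition π} = (equipartitions E (2 * T) : Set _) := by
      ext π; simp [equipartitions]
    have h2 : equipartitions E (2 * T) ∩ good =
        (equipartitions E (2 * T)).filter fun π => s ≤ ((shatteredPart 𝒞 π).card : ℝ) := by
      ext π; simp [good]
    have h3 : 0 < (equipartitions E (2 * T)).card := by
      obtain ⟨π, hπ⟩ := exists_isEquipartition E (t := 2 * T) (by omega)
      exact card_pos.2 ⟨π, mem_filter.2 ⟨mem_univ _, hπ⟩⟩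
    rw [hκ, h1, uniformOn_apply_finset, h2, ENNReal.le_div_iff_mul_le
      (Or.inl (by exact_mod_cast h3.ne')) (Or.inl (ENNReal.natCast_ne_top _))]
    have h4 := mul_exp_neg_mul_card_equipartitions_le hT h𝒞 hlarge hs0 hs
    rw [← ENNReal.ofReal_natCast, ← ENNReal.ofReal_natCast, ← ENNReal.ofReal_mul (by positivity)]
    exact ENNReal.ofReal_le_ofReal h4
  have hbad : κ (good : Set (E → Fin (2 * T)))ᶜ ≤ ENNReal.ofReal (Real.exp (-p)) := by
    rw [prob_compl_eq_one_sub (Set.toFinite _).measurableSet]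
    calc 1 - κ good ≤ 1 - ENNReal.ofReal p := tsub_le_tsub_left hgood _
      _ = ENNReal.ofReal (1 - p) := by
          rw [ENNReal.ofReal_sub _ (by positivity), ENNReal.ofReal_one]
      _ ≤ _ := ENNReal.ofReal_le_ofReal (by linarith [Real.add_one_le_exp (-p)])
  have hset : {πs : Fin (numIterations T) → E → Fin (2 * T) |
      ∀ i, ¬ s ≤ ((shatteredPart 𝒞 (πs i)).card : ℝ)} =
      Set.univ.pi fun _ => (good : Set (E → Fin (2 * T)))ᶜ := by
    ext πs; simp [good]
  rw [hset, Measure.pi_pi, Finset.prod_const, card_univ, Fintype.card_fin]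
  calc _ ≤ ENNReal.ofReal (Real.exp (-p)) ^ numIterations T := by gcongr
    _ = ENNReal.ofReal (Real.exp (-(numIterations T * p))) := by
        rw [← ENNReal.ofReal_pow (Real.exp_pos _).le, ← Real.exp_nat_mul]
        congr 2
        ring
    _ ≤ _ := by
        refine ENNReal.ofReal_le_ofReal (Real.exp_le_exp.2 ?_)
        have h1 : 10 * Real.exp (2 * T) ≤ numIterations T := Nat.le_ceil _
        have h2 : 10 * Real.exp (2 * T) * p = 4 * T := by
          have : Real.exp (2 * T) * Real.exp (-(2 * T)) = 1 := by rw [← Real.exp_add]; simp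
          calc _ = 4 * T * (Real.exp (2 * T) * Real.exp (-(2 * T))) := by simp only [p]; ring
            _ = 4 * T := by rw [this, mul_one]
        have h3 : 10 * Real.exp (2 * T) * p ≤ numIterations T * p := by gcongr
        linarith

/-- The error of the algorithm is at most the probability that no partition is accepted plus the
largest error given an accepted partition. -/
theorem one_sub_le_outputProb {N T : ℕ} (hT : 0 < T) {ε : ℝ}
    {pick : (E → Fin (2 * T)) → Finset (Finset E) → Finset (Finset E)}
    {𝒞 : Finset (Finset E)} (h𝒞 : ∀ F ∈ 𝒞, F.card ≤ 2 * T) (hlarge : 2 ^ (10 * T) ≤ 𝒞.card)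
    (hs : 10 * targetSize N T ε ≤ 𝒞.card * (0.1 : ℝ) ^ T)
    (μ : Measure (E → ℤˣ)) [IsProbabilityMeasure μ] {g : Guess} {q : ℝ} (hq0 : 0 ≤ q)
    (hq : ∀ π, targetSize N T ε ≤ ((shatteredPart 𝒞 π).card : ℝ) →
      (μ.prod (Measure.pi fun _ : E => volume.restrict (Set.Icc (0 : ℝ) 1)))
        {p | (if (N : ℝ) ^ (0.6 * ε) ≤ |coverPoly (restrictedPart N T ε pick 𝒞 π)
          (fun e => p.2 e * ((p.1 e : ℤ) : ℝ))| then Guess.planted else Guess.null) ≠ g} ≤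
      ENNReal.ofReal q) :
    1 - (Real.exp (-4 * T) + q) ≤ outputProb N T ε pick 𝒞 μ g := by
  have h1 := isProbabilityMeasure_uniformOn_isEquipartition (E := E) (t := 2 * T) (by omega)
  have h2 := isProbabilityMeasure_restrict_Icc
  set κ := Measure.pi fun _ : Fin (numIterations T) =>
    uniformOn {π : E → Fin (2 * T) | IsEquipartition π} with hκ
  set ζ := Measure.pi fun _ : E => volume.restrict (Set.Icc (0 : ℝ) 1) with hζ
  have hs0 : 0 ≤ targetSize N T ε := by unfold targetSize; positivity
  set first := fun πs : Fin (numIterations T) → E → Fin (2 * T) =>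
    (List.ofFn πs).find? fun π =>
      decide (targetSize N T ε ≤ ((shatteredPart 𝒞 π).card : ℝ))
  set verdict := fun (π : E → Fin (2 * T)) (p : (E → ℤˣ) × (E → ℝ)) =>
    if (N : ℝ) ^ (0.6 * ε) ≤ |coverPoly (restrictedPart N T ε pick 𝒞 π)
      (fun e => p.2 e * ((p.1 e : ℤ) : ℝ))| then Guess.planted else Guess.null
  set bad := fun πs : Fin (numIterations T) → E → Fin (2 * T) =>
    {p : (E → ℤˣ) × (E → ℝ) | ∃ π, first πs = some π ∧ verdict π p ≠ g}
  have hverdict : ∀ π, MeasurableSet {p | verdict π p ≠ g} := fun π => by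
    have hm : MeasurableSet {p : (E → ℤˣ) × (E → ℝ) | (N : ℝ) ^ (0.6 * ε) ≤
        |coverPoly (restrictedPart N T ε pick 𝒞 π) (fun e => p.2 e * ((p.1 e : ℤ) : ℝ))|} :=
      measurableSet_le measurable_const (measurable_maskedCoverPoly _).abs
    have : {p | verdict π p ≠ g} = {p : (E → ℤˣ) × (E → ℝ) | ((N : ℝ) ^ (0.6 * ε) ≤
        |coverPoly (restrictedPart N T ε pick 𝒞 π) (fun e => p.2 e * ((p.1 e : ℤ) : ℝ))| ∧
          Guess.planted ≠ g) ∨ (¬ (N : ℝ) ^ (0.6 * ε) ≤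
        |coverPoly (restrictedPart N T ε pick 𝒞 π) (fun e => p.2 e * ((p.1 e : ℤ) : ℝ))| ∧
          Guess.null ≠ g)} := by
      ext p
      simp only [verdict, Set.mem_ofPred_eq]
      split_ifs with h <;> simp [h]
    rw [this]
    exact (hm.inter (.const _)).union (hm.compl.inter (.const _))
  have hbad : ∀ πs, MeasurableSet (bad πs) := fun πs => by
    have : bad πs = ⋃ π, {p | first πs = some π} ∩ {p | verdict π p ≠ g} := by
      ext p; simp [bad]
    rw [this]
    exact MeasurableSet.iUnion fun π => (MeasurableSet.const _).inter (hverdict π)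
  have hbadle : ∀ πs, (μ.prod ζ) (bad πs) ≤ ENNReal.ofReal q := fun πs => by
    rcases h : first πs with _ | π
    · have : bad πs = ∅ := by ext p; simp [bad, h]
      rw [this, measure_empty]
      exact zero_le
    · have hacc : targetSize N T ε ≤ ((shatteredPart 𝒞 π).card : ℝ) := by
        simpa using List.find?_some h
      refine le_trans (measure_mono fun p hp => ?_) (hq π hacc)
      obtain ⟨π', hπ', hv⟩ := hp
      rw [h, Option.some.injEq] at hπ'
      subst hπ'
      exact hv
  have hκp : IsProbabilityMeasure κ := by rw [hκ]; infer_instance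
  have hζp : IsProbabilityMeasure ζ := by rw [hζ]; infer_instance
  have hcoin : coinLaw E T = κ.prod ζ := rfl
  set good : Set ((E → ℤˣ) × (Fin (numIterations T) → E → Fin (2 * T)) × (E → ℝ)) :=
    {ω | distinguish N T ε pick 𝒞 ω.1 ω.2.1 ω.2.2 = g}
  set rejected := {πs : Fin (numIterations T) → E → Fin (2 * T) |
    ∀ i, ¬ targetSize N T ε ≤ ((shatteredPart 𝒞 (πs i)).card : ℝ)}
  have hsub : goodᶜ ⊆ (Set.univ ×ˢ (rejected ×ˢ Set.univ)) ∪
      {ω | (ω.1, ω.2.2) ∈ bad ω.2.1} := by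
    intro ω hω
    rcases distinguish_cases N T ε pick 𝒞 ω.1 ω.2.1 ω.2.2 with h | ⟨i, hi, hd⟩
    · exact Or.inl ⟨trivial, h, trivial⟩
    · refine Or.inr ⟨_, hi, fun hv => hω ?_⟩
      exact hd.trans hv
  have hcompl : (μ.prod (κ.prod ζ)) goodᶜ ≤ ENNReal.ofReal (Real.exp (-4 * T) + q) := by
    refine (measure_mono hsub).trans ((measure_union_le _ _).trans ?_)
    rw [ENNReal.ofReal_add (Real.exp_pos _).le hq0]
    refine add_le_add ?_ (measure_prod_accepted_le μ κ ζ hbad hbadle)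
    rw [Measure.prod_prod, Measure.prod_prod, measure_univ, measure_univ, one_mul, mul_one]
    exact measure_forall_not_accepted_le hT h𝒞 hlarge hs0 hs
  have hcover : 1 ≤ (μ.prod (κ.prod ζ)).real good + (μ.prod (κ.prod ζ)).real goodᶜ := by
    have := measureReal_union_le (μ := μ.prod (κ.prod ζ)) good goodᶜ
    rwa [Set.union_compl_self, probReal_univ] at this
  have hreal : (μ.prod (κ.prod ζ)).real goodᶜ ≤ Real.exp (-4 * T) + q :=
    ENNReal.toReal_le_of_le_ofReal (by positivity) hcompl
  rw [outputProb, hcoin]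
  linarith

end Algorithm

/-! ### The two error probabilities -/

section Errors

variable {n k : ℕ} {G : UniformHypergraph n k}

theorem isProbabilityMeasure_plantedLaw {ρ : ℝ} (h0 : 0 ≤ ρ) (h1 : ρ ≤ 1) (z : Fin n → ℤˣ) :
    IsProbabilityMeasure (plantedLaw G ρ z) := by
  have := isProbabilityMeasure_signLaw h0 h1
  exact Measure.isProbabilityMeasure_map (UniformHypergraph.measurable_plant z).aemeasurable

/-- On even covers the planted assignment is invisible, and the polynomial is evaluated at
independent variables with law `noiseLaw ρ`, shifted by their mean `ρ / 2`. -/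
theorem measure_maskedCoverPoly_eq {ρ : ℝ} (h0 : 0 ≤ ρ) (h1 : ρ ≤ 1) (z : Fin n → ℤˣ)
    {𝒟 : Finset (Finset G.Edge)} (h𝒟 : ∀ F ∈ 𝒟, G.IsEvenCover F) {A : Set ℝ}
    (hA : MeasurableSet A) :
    ((plantedLaw G ρ z).prod (Measure.pi fun _ : G.Edge => volume.restrict (Set.Icc (0 : ℝ) 1)))
        {p | coverPoly 𝒟 (fun e => p.2 e * ((p.1 e : ℤ) : ℝ)) ∈ A} =
      (Measure.pi fun _ : G.Edge => noiseLaw ρ)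
        {x | coverPoly 𝒟 (fun e => ρ / 2 + x e) ∈ A} := by
  have := isProbabilityMeasure_signLaw h0 h1
  have := isProbabilityMeasure_restrict_Icc
  have hplant : MeasurePreserving (fun (η : G.Edge → ℤˣ) (e : G.Edge) => η e * ∏ v ∈ e.1, z v)
      (Measure.pi fun _ : G.Edge => signLaw ρ) (plantedLaw G ρ z) :=
    ⟨UniformHypergraph.measurable_plant z, rfl⟩
  have hprod := hplant.prod (MeasurePreserving.id
    (Measure.pi fun _ : G.Edge => volume.restrict (Set.Icc (0 : ℝ) 1)))
  have hS : MeasurableSet {p : (G.Edge → ℤˣ) × (G.Edge → ℝ) |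
      coverPoly 𝒟 (fun e => p.2 e * ((p.1 e : ℤ) : ℝ)) ∈ A} := measurable_maskedCoverPoly 𝒟 hA
  have hS' : MeasurableSet {x : G.Edge → ℝ | coverPoly 𝒟 (fun e => ρ / 2 + x e) ∈ A} :=
    ((measurable_coverPoly 𝒟).comp (by fun_prop : Measurable fun (x : G.Edge → ℝ) e =>
      ρ / 2 + x e)) hA
  rw [← hprod.measure_preimage hS.nullMeasurableSet,
    ← (measurePreserving_maskedSigns h0 h1).measure_preimage hS'.nullMeasurableSet]
  congr 1
  ext p
  simp only [Set.mem_preimage, Set.mem_ofPred_eq, Prod.map, id, add_sub_cancel]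
  rw [UniformHypergraph.coverPoly_mul_eq h𝒟]

theorem measure_null_error_le (z : Fin n → ℤˣ) {𝒟 : Finset (Finset G.Edge)}
    (h𝒟 : ∀ F ∈ 𝒟, G.IsEvenCover F) {θ : ℝ} (hθ : 0 < θ) :
    ((plantedLaw G 0 z).prod (Measure.pi fun _ : G.Edge => volume.restrict (Set.Icc (0 : ℝ) 1)))
        {p | θ ≤ |coverPoly 𝒟 (fun e => p.2 e * ((p.1 e : ℤ) : ℝ))|} ≤
      ENNReal.ofReal (𝒟.card / θ ^ 2) := by
  have := isProbabilityMeasure_noiseLaw le_rfl zero_le_one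
  have h1 := measure_maskedCoverPoly_eq le_rfl zero_le_one z h𝒟 (A := {y | θ ≤ |y|})
    (measurableSet_le measurable_const (by fun_prop))
  simp only [Set.mem_ofPred_eq] at h1
  rw [h1, ← ofReal_measureReal]
  refine ENNReal.ofReal_le_ofReal ?_
  simp only [zero_div, zero_add]
  exact measureReal_le_abs_coverPoly_le
    (fun _ => by simpa using ae_noiseLaw_abs_le le_rfl zero_le_one)
    (fun _ => integral_noiseLaw le_rfl zero_le_one) 𝒟 hθ

theorem measure_planted_error_le {ρ : ℝ} (h0 : 0 < ρ) (h1 : ρ ≤ 1) (z : Fin n → ℤˣ) {T : ℕ}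
    {π : G.Edge → Fin (2 * T)} {𝒟 : Finset (Finset G.Edge)} (h𝒟 : ∀ F ∈ 𝒟, G.IsEvenCover F)
    (hsh : ∀ F ∈ 𝒟, _root_.Shatters π F) (hcard : ∀ F ∈ 𝒟, F.card ≤ 2 * T) {s θ : ℝ} (hs : 0 < s)
    (hs𝒟 : s ≤ 𝒟.card) (hθ : 0 < θ) :
    ((plantedLaw G ρ z).prod (Measure.pi fun _ : G.Edge => volume.restrict (Set.Icc (0 : ℝ) 1)))
        {p | |coverPoly 𝒟 (fun e => p.2 e * ((p.1 e : ℤ) : ℝ))| < θ} ≤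
      ENNReal.ofReal (40002 ^ (2 * T) * (θ / (s * (ρ / 2) ^ (2 * T))) ^ (1 / 4 : ℝ)) := by
  have h2 := measure_maskedCoverPoly_eq h0.le h1 z h𝒟 (A := {y | |y| < θ})
    (measurableSet_lt (by fun_prop) measurable_const)
  simp only [Set.mem_ofPred_eq] at h2
  rw [h2]
  refine measure_abs_coverPoly_lt_le (fun _ => isNiceLaw_noiseLaw h0.le h1) hsh (by positivity) hθ
    ?_
  calc s * (ρ / 2) ^ (2 * T) ≤ 𝒟.card * (ρ / 2) ^ (2 * T) := by gcongr
    _ = ∑ F ∈ 𝒟, (ρ / 2) ^ (2 * T) := by rw [Finset.sum_const, nsmul_eq_mul]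
    _ ≤ coverPoly 𝒟 fun _ => ρ / 2 := by
        refine Finset.sum_le_sum fun F hF => ?_
        rw [Finset.prod_const]
        exact pow_le_pow_of_le_one (by linarith) (by linarith) (hcard F hF)

end Errors

/-! ### The choice of parameters -/

/-- The hypothesis on `T`, freed from logarithms. -/
theorem pow_lt_rpow_of_lt_div_logb {N : ℕ} {T : ℕ} {ε D : ℝ} (hD : 1 < D)
    (h : (T : ℝ) < 0.4 * ε * Real.logb 2 N / Real.logb 2 D) :
    0 < N ∧ D ^ T < (N : ℝ) ^ (0.4 * ε) := by
  have hlogD : 0 < Real.logb 2 D := Real.logb_pos (by norm_num) hD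
  have hN : 0 < N := by
    rcases Nat.eq_zero_or_pos N with rfl | hN
    · simp only [Nat.cast_zero, Real.logb_zero, mul_zero, zero_div] at h
      exact absurd h (not_lt.2 (Nat.cast_nonneg T))
    · exact hN
  refine ⟨hN, ?_⟩
  have hN' : (0 : ℝ) < N := by exact_mod_cast hN
  rw [lt_div_iff₀ hlogD] at h
  rw [← Real.logb_lt_logb_iff (b := 2) (by norm_num) (by positivity)
    (Real.rpow_pos_of_pos hN' _), Real.logb_pow, Real.logb_rpow_eq_mul_logb_of_pos hN']
  exact h

theorem half_pow_le_of_four_mul_logb_lt {δ : ℝ} (hδ : 0 < δ) {T : ℕ}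
    (h : 4 * Real.logb 2 (1 / δ) < T) : (1 / 2 : ℝ) ^ T ≤ δ := by
  rcases le_or_gt 1 δ with h1 | h1
  · exact (pow_le_one₀ (by norm_num) (by norm_num)).trans h1
  have hlog : 0 ≤ Real.logb 2 (1 / δ) :=
    Real.logb_nonneg (by norm_num) (by rw [le_div_iff₀ hδ]; linarith)
  have h2 : Real.logb 2 (1 / δ) < T := by linarith
  rw [Real.logb_lt_iff_lt_rpow (by norm_num) (by positivity), Real.rpow_natCast,
    div_lt_iff₀ hδ] at h2
  rw [div_pow, one_pow, div_le_iff₀ (by positivity)]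
  linarith

/-- In terms of `u = N ^ (0.2 ε)`: the variance bound beats the threshold `u ^ 3`. -/
theorem null_error_arith {u : ℝ} {T : ℕ} (hu : (10 : ℝ) ^ T ≤ u ^ 2) (hu2 : 2 ≤ u) :
    (u ^ 5 * (0.1 : ℝ) ^ T + 1) / (u ^ 3) ^ 2 ≤ (1 / 4) ^ T := by
  have h10 : (0.1 : ℝ) ^ T * 10 ^ T = 1 := by rw [← mul_pow]; norm_num
  have hpos : (0 : ℝ) < 0.1 ^ T := by positivity
  have h1 : 1 ≤ u ^ 5 * (0.1 : ℝ) ^ T := by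
    have h2 : 1 ≤ u ^ 2 * (0.1 : ℝ) ^ T := by
      rw [← h10, mul_comm]; gcongr
    have h3 : 1 ≤ u ^ 3 := one_le_pow₀ (by linarith)
    calc (1 : ℝ) = 1 * 1 := by norm_num
      _ ≤ u ^ 3 * (u ^ 2 * (0.1 : ℝ) ^ T) := by gcongr
      _ = _ := by ring
  rw [div_le_iff₀ (by positivity)]
  calc u ^ 5 * (0.1 : ℝ) ^ T + 1 ≤ 2 * (u ^ 5 * (0.1 : ℝ) ^ T) := by linarith
    _ ≤ u * (u ^ 5 * (0.1 : ℝ) ^ T) := by gcongr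
    _ = (0.1 : ℝ) ^ T * (u ^ 3) ^ 2 := by ring
    _ ≤ (1 / 4) ^ T * (u ^ 3) ^ 2 := by gcongr; norm_num

/-- In terms of `u = N ^ (0.2 ε)`: the ratio of the threshold to the mean of the polynomial beats
the constants lost in the `2 T` linear steps. -/
theorem planted_error_arith {u ρ : ℝ} {T : ℕ} (hρ : 0 < ρ) (hρ1 : ρ ≤ 1) (hu0 : 0 < u)
    (hu : (10 * 20000 ^ 40 * (ρ ^ 4)⁻¹ : ℝ) ^ T ≤ u ^ 2) :
    40002 ^ (2 * T) * (u ^ 3 / (u ^ 5 * (0.1 : ℝ) ^ T * (ρ / 2) ^ (2 * T))) ^ (1 / 4 : ℝ) ≤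
      (1 / 4 : ℝ) ^ T := by
  set y : ℝ := (1 / (4 * 40002 ^ 2)) ^ T with hy
  have hy0 : 0 ≤ y := by positivity
  have h1 : u ^ 3 / (u ^ 5 * (0.1 : ℝ) ^ T * (ρ / 2) ^ (2 * T)) ≤ y ^ 4 := by
    have e1 : (0.1 : ℝ) ^ T * (ρ / 2) ^ (2 * T) = (ρ ^ 2 / 40) ^ T := by
      rw [pow_mul, ← mul_pow]; congr 1; ring
    have e2 : y ^ 4 = ((1 / (4 * 40002 ^ 2)) ^ 4) ^ T := by
      rw [hy]
      exact pow_right_comm _ _ _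
    rw [mul_assoc, e1, e2, div_le_iff₀ (by positivity)]
    have h2 : (1 : ℝ) ≤ (1 / (4 * 40002 ^ 2)) ^ 4 *
        (10 * 20000 ^ 40 * (ρ ^ 4)⁻¹ * (ρ ^ 2 / 40)) := by
      have h3 : 10 * 20000 ^ 40 * (ρ ^ 4)⁻¹ * (ρ ^ 2 / 40) = 20000 ^ 40 / 4 * (ρ ^ 2)⁻¹ := by
        field_simp
        norm_num
      rw [h3]
      have h4 : 1 ≤ (ρ ^ 2)⁻¹ :=
        (one_le_inv₀ (by positivity)).2 (pow_le_one₀ hρ.le hρ1)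
      calc (1 : ℝ) ≤ (1 / (4 * 40002 ^ 2)) ^ 4 * (20000 ^ 40 / 4 * 1) := by norm_num
        _ ≤ _ := by gcongr
    calc u ^ 3 = u ^ 3 * 1 ^ T := by rw [one_pow, mul_one]
      _ ≤ u ^ 3 * ((1 / (4 * 40002 ^ 2)) ^ 4 *
          (10 * 20000 ^ 40 * (ρ ^ 4)⁻¹ * (ρ ^ 2 / 40))) ^ T := by gcongr
      _ = ((1 / (4 * 40002 ^ 2)) ^ 4) ^ T * (u ^ 3 *
          (10 * 20000 ^ 40 * (ρ ^ 4)⁻¹) ^ T * (ρ ^ 2 / 40) ^ T) := by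
          rw [mul_pow, mul_pow (10 * 20000 ^ 40 * (ρ ^ 4)⁻¹)]
          ring
      _ ≤ ((1 / (4 * 40002 ^ 2)) ^ 4) ^ T * (u ^ 3 * u ^ 2 * (ρ ^ 2 / 40) ^ T) := by gcongr
      _ = _ := by ring
  have h2 : (u ^ 3 / (u ^ 5 * (0.1 : ℝ) ^ T * (ρ / 2) ^ (2 * T))) ^ (1 / 4 : ℝ) ≤ y := by
    calc _ ≤ (y ^ 4) ^ (1 / 4 : ℝ) := Real.rpow_le_rpow (by positivity) h1 (by norm_num)
      _ = y := by
        rw [← Real.rpow_natCast, ← Real.rpow_mul hy0]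
        norm_num
  calc _ ≤ 40002 ^ (2 * T) * y := by gcongr
    _ = _ := by
      rw [hy, pow_mul, ← mul_pow]
      congr 1
      norm_num

theorem mainTheorem4 :
    ∃ C : ℝ, IsAnticoncentrationConstant C ∧
      ∀ (n k l T : ℕ) (G : UniformHypergraph n k) (ρ δ ε : ℝ),
        0 < ρ → ρ ≤ 1 → 0 < δ → 0 < ε →
        4 * Real.logb 2 (1 / δ) < (T : ℝ) →
        (T : ℝ) < 0.4 * ε * Real.logb 2 (n.choose l : ℝ) /
          Real.logb 2 (10 * C ^ 40 * (ρ ^ 4)⁻¹) →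
        ∀ 𝒞 : Finset (Finset G.Edge),
          (∀ F ∈ 𝒞, F.Nonempty ∧ G.IsEvenCover F ∧ F.card ≤ 2 * T) →
          10 * (n.choose l : ℝ) ^ ε ≤ (𝒞.card : ℝ) →
          ∀ pick : (G.Edge → Fin (2 * T)) → Finset (Finset G.Edge) → Finset (Finset G.Edge),
            IsRestrictionRule (targetSize (n.choose l) T ε) pick →
            ∀ z : Fin n → ℤˣ,
              1 - δ ≤ outputProb (n.choose l) T ε pick 𝒞 (plantedLaw G 0 z) Guess.null ∧
              1 - δ ≤ outputProb (n.choose l) T ε pick 𝒞 (plantedLaw G ρ z) Guess.planted := by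
  refine ⟨20000, isAnticoncentrationConstant_20000, ?_⟩
  intro n k l T G ρ δ ε hρ hρ1 hδ hε hTδ hTN 𝒞 h𝒞 hcard pick hpick z
  have hδT := half_pow_le_of_four_mul_logb_lt hδ hTδ
  rcases Nat.eq_zero_or_pos T with rfl | hT
  · have : 1 ≤ δ := by simpa using hδT
    exact ⟨le_trans (by linarith) measureReal_nonneg, le_trans (by linarith) measureReal_nonneg⟩
  set N := n.choose l
  have hρ4 : 1 ≤ (ρ ^ 4)⁻¹ := (one_le_inv₀ (by positivity)).2 (pow_le_one₀ hρ.le hρ1)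
  have hD : (10 * 20000 ^ 40 : ℝ) ≤ 10 * 20000 ^ 40 * (ρ ^ 4)⁻¹ :=
    le_mul_of_one_le_right (by positivity) hρ4
  obtain ⟨hN, hDT⟩ := pow_lt_rpow_of_lt_div_logb (lt_of_lt_of_le (by norm_num) hD) hTN
  have hN' : (0 : ℝ) < N := by exact_mod_cast hN
  set u : ℝ := (N : ℝ) ^ (0.2 * ε) with hu
  have hu0 : 0 < u := Real.rpow_pos_of_pos hN' _
  have hupow : ∀ (m : ℕ) (a : ℝ), 0.2 * m = a → (N : ℝ) ^ (a * ε) = u ^ m := fun m a ha => by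
    rw [hu, ← Real.rpow_natCast, ← Real.rpow_mul hN'.le, ← ha]
    ring_nf
  have hu5 : (N : ℝ) ^ ε = u ^ 5 := by simpa using hupow 5 1 (by norm_num)
  have hu3 : (N : ℝ) ^ (0.6 * ε) = u ^ 3 := hupow 3 0.6 (by norm_num)
  rw [hupow 2 0.4 (by norm_num)] at hDT
  have htarget : targetSize N T ε = u ^ 5 * (0.1 : ℝ) ^ T := by rw [targetSize, hu5]
  have hbig : ∀ a : ℝ, 0 ≤ a → a ≤ 10 * 20000 ^ 40 → a ^ T ≤ u ^ 2 := fun a ha h =>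
    (pow_le_pow_left₀ ha (h.trans hD) T).trans hDT.le
  have hu2 : 2 ≤ u := by
    have h4 : (4 : ℝ) ≤ u ^ 2 :=
      (le_self_pow₀ (by norm_num) hT.ne').trans (hbig 4 (by norm_num) (by norm_num))
    nlinarith
  have hlarge : 2 ^ (10 * T) ≤ 𝒞.card := by
    have h1 : ((2 : ℝ) ^ 10) ^ T ≤ u ^ 2 := hbig _ (by norm_num) (by norm_num)
    have h2 : u ^ 2 ≤ u ^ 5 := pow_le_pow_right₀ (by linarith) (by norm_num)
    have h3 : (2 : ℝ) ^ (10 * T) ≤ 𝒞.card := by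
      rw [pow_mul]
      rw [hu5] at hcard
      linarith [pow_pos hu0 5]
    exact_mod_cast h3
  have hs : 10 * targetSize N T ε ≤ 𝒞.card * (0.1 : ℝ) ^ T := by
    rw [hu5] at hcard
    rw [htarget, ← mul_assoc]
    gcongr
  have hsize : ∀ F ∈ 𝒞, F.card ≤ 2 * T := fun F hF => (h𝒞 F hF).2.2
  -- both the rejection probability and either error probability are at most `4 ^ (-T)`
  have hδ' : Real.exp (-4 * T) + (1 / 4 : ℝ) ^ T ≤ δ := by
    have h1 : Real.exp (-4 * T) ≤ (1 / 4 : ℝ) ^ T := by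
      have h2 : Real.exp (-4) ≤ 1 / 4 := by
        rw [Real.exp_neg, one_div]
        exact inv_anti₀ (by norm_num) (by linarith [Real.add_one_le_exp (4 : ℝ)])
      calc Real.exp (-4 * T) = Real.exp (-4) ^ T := by rw [← Real.exp_nat_mul]; congr 1; ring
        _ ≤ _ := by gcongr
    have h3 : (1 / 4 : ℝ) ^ T = (1 / 2) ^ T * (1 / 2) ^ T := by rw [← mul_pow]; norm_num
    have h4 : (1 / 2 : ℝ) ^ T ≤ 1 / 2 := by
      calc (1 / 2 : ℝ) ^ T ≤ (1 / 2) ^ 1 := pow_le_pow_of_le_one (by norm_num) (by norm_num) hT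
        _ = 1 / 2 := pow_one _
    have h5 : (0 : ℝ) < (1 / 2) ^ T := by positivity
    nlinarith
  have hsub : ∀ π, targetSize N T ε ≤ ((shatteredPart 𝒞 π).card : ℝ) →
      ∀ F ∈ restrictedPart N T ε pick 𝒞 π, F ∈ 𝒞 ∧ _root_.Shatters π F := fun π hπ F hF =>
    mem_filter.1 ((restrictedPart_spec hpick hπ).1 hF)
  constructor
  · have := isProbabilityMeasure_plantedLaw (G := G) le_rfl zero_le_one z
    refine le_trans (by linarith) (one_sub_le_outputProb (pick := pick) hT hsize hlarge hs
      (plantedLaw G 0 z) (q := (1 / 4) ^ T) (by positivity) fun π hπ => ?_)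
    refine le_trans (measure_mono fun p hp => ?_) ((measure_null_error_le z
      (fun F hF => (h𝒞 F (hsub π hπ F hF).1).2.1) (pow_pos hu0 3)).trans
        (ENNReal.ofReal_le_ofReal ?_))
    · by_contra hlt
      exact hp (if_neg (by rw [hu3]; exact hlt))
    · refine le_trans ?_ (null_error_arith (hbig 10 (by norm_num) (by norm_num)) hu2)
      gcongr
      rw [← htarget]
      exact (restrictedPart_spec hpick hπ).2.2
  · have := isProbabilityMeasure_plantedLaw (G := G) hρ.le hρ1 z
    refine le_trans (by linarith) (one_sub_le_outputProb (pick := pick) hT hsize hlarge hs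
      (plantedLaw G ρ z) (q := (1 / 4) ^ T) (by positivity) fun π hπ => ?_)
    refine le_trans (measure_mono fun p hp => ?_) ((measure_planted_error_le hρ hρ1 z
      (fun F hF => (h𝒞 F (hsub π hπ F hF).1).2.1) (fun F hF => (hsub π hπ F hF).2)
      (fun F hF => hsize F (hsub π hπ F hF).1) (s := u ^ 5 * (0.1 : ℝ) ^ T) (by positivity)
      (htarget ▸ (restrictedPart_spec hpick hπ).2.1) (pow_pos hu0 3)).trans
        (ENNReal.ofReal_le_ofReal (planted_error_arith hρ hρ1 hu0 hDT.le)))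
    by_contra hlt
    exact hp (if_pos (by rw [hu3]; exact not_lt.1 hlt))
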